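/- **Conventions.** Fix a finite set $\mathcal A$ of uninterpreted action symbols, a finite set $\mathcal C$ of channels and a finite set $\mathcal D$ of data symbols containing three distinct symbols $1$, $[\![$ and $]\!]$. Let $\mathcal D_\Box=\mathcal D\cup\{\Box\}$, where $\Box\notin\mathcal D$ is the blank. The set of actions $\mathrm{Act}$ consists of the elements of $\mathcal A$ and the actions $c!d$ (send) and $c?d$ (receive) for $c\in\mathcal C$, $d\in\mathcal D_\Box$; let $\mathrm{Act}_\tau=\mathrm{Act}\cup\{\tau\}$ with $\tau\notin\mathrm{Act}$ unobservable. Fix a dedicated channel $u\in\mathcal C$. A *transition system* is a set of states with a relation $\to\ \subseteq S\times\mathrm{Act}_\tau\times S$, an initial state and a set of final states. Transition systems $T_1,T_2$ are *branching bisimilar*, $T_1\leftrightarroweq_b T_2$, if there is a relation $R\subseteq S_1\times S_2$ relating the initial states such that $s_1\,R\,s_2$ implies: if $s_1\xrightarrow{a}s_1'$ then there are $s_2'',s_2'$ with $s_2\,(\xrightarrow{\tau})^*\,s_2''$, either $s_2''\xrightarrow{a}s_2'$ or ($a=\tau$ and $s_2''=s_2'$), $s_1\,R\,s_2''$ and $s_1'\,R\,s_2'$;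 if $s_1$ is final then there is a final $s_2'$ with $s_2\,(\xrightarrow{\tau})^*\,s_2'$ and $s_1\,R\,s_2'$; and both conditions hold with the two sides exchanged. (No condition on divergence is imposed.) The *parallel composition* $[T_1\parallel T_2]_{\{u\}}$ has state set $S_1\times S_2$; its transitions are the transitions of either component (the other staying put) with a label other than $u!d$, $u?d$, together with a $\tau$-transition whenever one component does $u!d$ and simultaneously the other does $u?d$ for some $d\in\mathcal D_\Box$; its initial state is the pair of initial states, and a pair is final iff both components are. A *reactive Turing machine* (RTM) consists of a finite set $S$ of states, a transition relation $\subseteq S\times\mathcal D_\Box\times\mathrm{Act}_\tau\times\mathcal D_\Box\times\{L,R\}\times S$, an initial state and a set of final states. Its transition system $\mathcal T(M)$ has as states the pairs of a state of $M$ and a two-way infinite tape over $\mathcal D_\Box$, all but finitely many cells of which are blank, with a head position (up to translation). Each transition $(s,d,a,e,m,t)$ of $M$ gives an $a$-labelled transition from every configuration with state $s$ and scanned symbol $d$ to the configuration with state $t$ obtained by writing $e$ over $d$ and moving the head one cell in direction $m$. The initial configuration consists of the initial state and the blank tape, and a configuration is final iff its state is. Fix numberings (injections into $\mathbb N$) of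 $\mathcal A$, $\mathcal C$ and $\mathcal D$. A *Gödel number* of an RTM $M$ with $n$ states is obtained by numbering its states bijectively by $0,\dots,n-1$ and coding, by means of the standard recursive coding of tuples and lists, the number $n$, the number of the initial state, the list of the numbers of the final states, and the list of the codes of the transitions. For $k\in\mathbb N$, let $\overline{k}$ be the RTM with a linear chain of states that sends along $u$ the symbol $[\![$, then $k+1$ symbols $1$, then $]\!]$, and thereupon halts in its unique final state. **Statement.** There exists an RTM $U$ such that, for every RTM $M$ none of whose transitions is labelled with an action $u!d$ or $u?d$, and for every Gödel number $k$ of $M$, $$\mathcal T(M)\ \leftrightarroweq_b\ [\mathcal T(\overline{k})\parallel \mathcal T(U)]_{\{u\}} .$$ -/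

import Mathlib

universe uA uC uD v v₁ v₂

/-- Observable actions. `A` is the set of uninterpreted action symbols, `C` the set of channels and
`D` the set of data symbols. Tape symbols are the elements of `Option D`, with `none` the blank
symbol; `send c d` and `recv c d` are the actions of sending and receiving the tape symbol `d`
along channel `c`. -/
inductive CommAction (A : Type uA) (C : Type uC) (D : Type uD) where
  | obs (a : A) : CommAction A C D
  | send (c : C) (d : Option D) : CommAction A C D
  | recv (c : C) (d : Option D) : CommAction A C D

/-- Actions together with the unobservable event `τ`, which is represented by `none`. -/
abbrev CommActionTau (A : Type uA) (C : Type uC) (D : Type uD) := Option (CommAction A C D)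

/-- Actions as elements of a disjoint union. -/
def CommAction.equivSum (A : Type uA) (C : Type uC) (D : Type uD) :
    CommAction A C D ≃ A ⊕ ((C × Option D) ⊕ (C × Option D)) where
  toFun
    | .obs a => .inl a
    | .send c d => .inr (.inl (c, d))
    | .recv c d => .inr (.inr (c, d))
  invFun
    | .inl a => .obs a
    | .inr (.inl (c, d)) => .send c d
    | .inr (.inr (c, d)) => .recv c d
  left_inv := by rintro (_ | _ | _) <;> rfl
  right_inv := by rintro (_ | ⟨_, _⟩ | ⟨_, _⟩) <;> rfl

instance CommAction.instFinite (A : Type uA) (C : Type uC) (D : Type uD)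
    [Finite A] [Finite C] [Finite D] : Finite (CommAction A C D) :=
  Finite.of_equiv _ (CommAction.equivSum A C D).symm

instance CommAction.instEncodable (A : Type uA) (C : Type uC) (D : Type uD)
    [Encodable A] [Encodable C] [Encodable D] : Encodable (CommAction A C D) :=
  Encodable.ofEquiv _ (CommAction.equivSum A C D)

/-- Head movements as Booleans. -/
def dirEquivBool : Turing.Dir ≃ Bool where
  toFun
    | .left => false
    | .right => true
  invFun
    | false => .left
    | true => .right
  left_inv := by rintro (_ | _) <;> rfl
  right_inv := by rintro (_ | _) <;> rfl

/-- An `CommActionTau A C D`-labelled transition system. -/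
structure TransitionSystem (A : Type uA) (C : Type uC) (D : Type uD) where
  State : Type v
  step : State → CommActionTau A C D → State → Prop
  init : State
  final : Set State

namespace TransitionSystem

variable {A : Type uA} {C : Type uC} {D : Type uD}

/-- `s` reaches `t` by zero or more `τ`-steps. -/
def TauSteps (T : TransitionSystem A C D) : T.State → T.State → Prop :=
  Relation.ReflTransGen (fun s t => T.step s none t)

/-- Either an `a`-step from `s` to `t`, or `a = τ` and `s = t`. -/
def OptStep (T : TransitionSystem A C D) (s : T.State) (a : CommActionTau A C D)
    (t : T.State) : Prop :=
  T.step s a t ∨ (a = none ∧ s = t)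

/-- `R` is a branching bisimulation from `T₁` to `T₂` (no condition on divergence). -/
structure IsBranchingBisimulation (T₁ : TransitionSystem.{uA, uC, uD, v₁} A C D)
    (T₂ : TransitionSystem.{uA, uC, uD, v₂} A C D)
    (R : T₁.State → T₂.State → Prop) : Prop where
  step_left : ∀ s₁ s₂, R s₁ s₂ → ∀ a s₁', T₁.step s₁ a s₁' →
    ∃ s₂'' s₂', T₂.TauSteps s₂ s₂'' ∧ T₂.OptStep s₂'' a s₂' ∧ R s₁ s₂'' ∧ R s₁' s₂'
  step_right : ∀ s₁ s₂, R s₁ s₂ → ∀ a s₂', T₂.step s₂ a s₂' →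
    ∃ s₁'' s₁', T₁.TauSteps s₁ s₁'' ∧ T₁.OptStep s₁'' a s₁' ∧ R s₁'' s₂ ∧ R s₁' s₂'
  final_left : ∀ s₁ s₂, R s₁ s₂ → s₁ ∈ T₁.final →
    ∃ s₂', T₂.TauSteps s₂ s₂' ∧ R s₁ s₂' ∧ s₂' ∈ T₂.final
  final_right : ∀ s₁ s₂, R s₁ s₂ → s₂ ∈ T₂.final →
    ∃ s₁', T₁.TauSteps s₁ s₁' ∧ R s₁' s₂ ∧ s₁' ∈ T₁.final

/-- Branching bisimilarity (divergence-insensitive). -/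
def BranchingBisimilar (T₁ : TransitionSystem.{uA, uC, uD, v₁} A C D)
    (T₂ : TransitionSystem.{uA, uC, uD, v₂} A C D) : Prop :=
  ∃ R : T₁.State → T₂.State → Prop, IsBranchingBisimulation T₁ T₂ R ∧ R T₁.init T₂.init

/-- The label `a` is a send or receive action along one of the channels in `K`. -/
def CommunicatesOn (K : Set C) (a : CommActionTau A C D) : Prop :=
  ∃ c ∈ K, ∃ d : Option D, a = some (.send c d) ∨ a = some (.recv c d)

/-- The parallel composition `[T₁ ∥ T₂]_K`: interleaving, with send and receive actions along the
channels in `K` only occurring as synchronisations, which become `τ`-steps. -/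
def parallel (K : Set C) (T₁ : TransitionSystem.{uA, uC, uD, v₁} A C D)
    (T₂ : TransitionSystem.{uA, uC, uD, v₂} A C D) :
    TransitionSystem A C D where
  State := T₁.State × T₂.State
  step s a s' :=
    ¬ CommunicatesOn K a ∧
      (((T₁.step s.1 a s'.1 ∧ s.2 = s'.2) ∨ (T₂.step s.2 a s'.2 ∧ s.1 = s'.1)) ∨
        (a = none ∧ ∃ c ∈ K, ∃ d : Option D,
          (T₁.step s.1 (some (.send c d)) s'.1 ∧ T₂.step s.2 (some (.recv c d)) s'.2) ∨
          (T₁.step s.1 (some (.recv c d)) s'.1 ∧ T₂.step s.2 (some (.send c d)) s'.2)))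
  init := (T₁.init, T₂.init)
  final := {s | s.1 ∈ T₁.final ∧ s.2 ∈ T₂.final}

end TransitionSystem

/-- A reactive Turing machine. A transition `(s, d, a, e, m, t)` means: in state `s`, reading the
tape symbol `d`, the machine may execute `a`, replace `d` by `e`, move the head in direction `m` and
end up in state `t`. -/
structure RTM (A : Type uA) (C : Type uC) (D : Type uD) where
  State : Type v
  finite_state : Finite State
  rel : Set (State × Option D × CommActionTau A C D × Option D × Turing.Dir × State)
  init : State
  final : Set State

namespace RTM

variable {A : Type uA} {C : Type uC} {D : Type uD}

/-- The transition system associated with an RTM. A configuration is a state together with a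
two-way infinite tape, all but finitely many cells of which are blank, with a head position;
initially the tape is empty. -/
def lts (M : RTM A C D) : TransitionSystem A C D where
  State := M.State × Turing.Tape (Option D)
  step x a y := ∃ (e : Option D) (m : Turing.Dir),
    (x.1, x.2.head, a, e, m, y.1) ∈ M.rel ∧ y.2 = (x.2.write e).move m
  init := (M.init, Turing.Tape.mk₁ [])
  final := {x | x.1 ∈ M.final}

/-- No transition of `M` is labelled with a send or receive action along channel `u`. -/
def DoesNotUse (M : RTM A C D) (u : C) : Prop :=
  ∀ s d a e m t, (s, d, a, e, m, t) ∈ M.rel → ¬ TransitionSystem.CommunicatesOn {u} a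

/-- The number of a transition, given numbers for the states. -/
def transCode [Encodable A] [Encodable C] [Encodable D] {Q : Type*} {n : ℕ} (ν : Q ≃ Fin n) :
    Q × Option D × CommActionTau A C D × Option D × Turing.Dir × Q → ℕ
  | (s, d, a, e, m, t) =>
    Encodable.encode ((ν s : ℕ), d, a, e, dirEquivBool m, (ν t : ℕ))

section Godel

variable [Finite A] [Finite C] [Finite D] [Encodable A] [Encodable C] [Encodable D]

/-- The finite set of the numbers of all transitions of `M`. -/
noncomputable def transCodes (M : RTM A C D) {n : ℕ} (ν : M.State ≃ Fin n) : Finset ℕ :=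
  haveI := M.finite_state
  haveI : Finite Turing.Dir := Finite.of_equiv _ dirEquivBool.symm
  ((Set.toFinite M.rel).image (transCode ν)).toFinset

/-- The finite set of the numbers of all final states of `M`. -/
noncomputable def finalCodes (M : RTM A C D) {n : ℕ} (ν : M.State ≃ Fin n) : Finset ℕ :=
  haveI := M.finite_state
  ((Set.toFinite M.final).image (fun s => (ν s : ℕ))).toFinset

/-- The Gödel number of `M` with respect to the numbering `ν` of its states: the standard code of
the number of states, the number of the initial state, the increasing list of the numbers of the
final states and the increasing list of the numbers of the transitions. -/
noncomputable def godelNumber (M : RTM A C D) {n : ℕ} (ν : M.State ≃ Fin n) : ℕ :=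
  Encodable.encode (n, (ν M.init : ℕ), (M.finalCodes ν).sort (· ≤ ·), (M.transCodes ν).sort (· ≤ ·))

end Godel

/-- The RTM that outputs the symbols of the word `w` one by one along channel `u` and then halts in
its unique final state. -/
def sendWord (A : Type uA) {C : Type uC} {D : Type uD} (u : C) (w : List D) :
    RTM.{uA, uC, uD, 0} A C D where
  State := Fin (w.length + 1)
  finite_state := inferInstance
  rel := {x | ∃ i : Fin w.length,
    x = (i.castSucc, none, some (.send u (some (w.get i))), none, Turing.Dir.right, i.succ)}
  init := 0
  final := {Fin.last w.length}

/-- The RTM that outputs the number `k` along channel `u`, as a sequence of `k + 1` symbols `one`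
delimited by the symbols `lb` and `rb`, and then halts in its unique final state. -/
def sendNumber (A : Type uA) {C : Type uC} {D : Type uD} (u : C) (one lb rb : D) (k : ℕ) :
    RTM.{uA, uC, uD, 0} A C D :=
  sendWord A u ([lb] ++ List.replicate (k + 1) one ++ [rb])

end RTM

/-!
It is easier to program a machine that keeps a single datum of an arbitrary type and updates it by
computable functions. Such a machine is branching bisimilar to a reactive Turing machine that keeps
a code of the datum on its tape: by Mathlib's compilation of partial recursive functions to Turing
machines, the new code and the result of a test can be computed by deterministic silent steps, and
deterministic silent steps are inert.

The universal machine first receives the Gödel number `k`. The communications that transmit `k` are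
the only steps possible at that stage, so they are inert as well. It then interprets the machine
with Gödel number `k`, whose next transition it guesses. Each guess can be revised by silent steps,
so no behaviour is discarded before an action is executed, and the search for a transition is inert,
too. Branching bisimilarity is transitive and preserved by parallel composition, which combines the
three parts.
-/

/-! ### Branching bisimilarity -/

universe v₃

namespace TransitionSystem

variable {A : Type uA} {C : Type uC} {D : Type uD}
  {T₁ : TransitionSystem.{uA, uC, uD, v₁} A C D} {T₂ : TransitionSystem.{uA, uC, uD, v₂} A C D}
  {T₃ : TransitionSystem.{uA, uC, uD, v₃} A C D}
  {R : T₁.State → T₂.State → Prop} {R' : T₂.State → T₃.State → Prop}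

/-- The half of the conditions on a branching bisimulation that match what the left system does by
what the right system does. -/
structure IsBranchingSimulation (T₁ : TransitionSystem.{uA, uC, uD, v₁} A C D)
    (T₂ : TransitionSystem.{uA, uC, uD, v₂} A C D) (R : T₁.State → T₂.State → Prop) : Prop where
  step : ∀ {s t}, R s t → ∀ {a s'}, T₁.step s a s' →
    ∃ t'' t', T₂.TauSteps t t'' ∧ T₂.OptStep t'' a t' ∧ R s t'' ∧ R s' t'
  final : ∀ {s t}, R s t → s ∈ T₁.final → ∃ t', T₂.TauSteps t t' ∧ R s t' ∧ t' ∈ T₂.final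

theorem isBranchingBisimulation_iff : IsBranchingBisimulation T₁ T₂ R ↔
    IsBranchingSimulation T₁ T₂ R ∧ IsBranchingSimulation T₂ T₁ (flip R) where
  mp h := ⟨⟨fun hst => h.step_left _ _ hst _ _, fun hst => h.final_left _ _ hst⟩,
    ⟨fun hst => h.step_right _ _ hst _ _, fun hst => h.final_right _ _ hst⟩⟩
  mpr h := ⟨fun _ _ hst _ _ => h.1.step hst, fun _ _ hst _ _ => h.2.step hst,
    fun _ _ hst => h.1.final hst, fun _ _ hst => h.2.final hst⟩

theorem branchingBisimilar_iff : BranchingBisimilar T₁ T₂ ↔ ∃ R : T₁.State → T₂.State → Prop,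
    IsBranchingSimulation T₁ T₂ R ∧ IsBranchingSimulation T₂ T₁ (flip R) ∧ R T₁.init T₂.init := by
  simp only [BranchingBisimilar, isBranchingBisimulation_iff, and_assoc]

namespace IsBranchingSimulation

theorem of_optStep
    (step : ∀ {s t}, R s t → ∀ {a s'}, T₁.step s a s' → ∃ t', T₂.OptStep t a t' ∧ R s' t')
    (final : ∀ {s t}, R s t → s ∈ T₁.final → t ∈ T₂.final) : IsBranchingSimulation T₁ T₂ R where
  step {_ t} hst _ _ hs :=
    let ⟨t', ht, hst'⟩ := step hst hs
    ⟨t, t', .refl, ht, hst, hst'⟩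
  final {_ t} hst hs := ⟨t, .refl, hst, final hst hs⟩

theorem tauSteps (h : IsBranchingSimulation T₁ T₂ R) {s s' : T₁.State} {t : T₂.State}
    (hst : R s t) (hs : T₁.TauSteps s s') : ∃ t', T₂.TauSteps t t' ∧ R s' t' := by
  induction hs with
  | refl => exact ⟨t, .refl, hst⟩
  | tail _ hstep ih =>
    obtain ⟨t₁, ht₁, hst₁⟩ := ih
    obtain ⟨t₂, t₃, ht₂, ht₃ | ⟨-, rfl⟩, -, hst₃⟩ := h.step hst₁ hstep
    · exact ⟨t₃, (ht₁.trans ht₂).tail ht₃, hst₃⟩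
    · exact ⟨t₂, ht₁.trans ht₂, hst₃⟩

theorem comp (h : IsBranchingSimulation T₁ T₂ R) (h' : IsBranchingSimulation T₂ T₃ R') :
    IsBranchingSimulation T₁ T₃ (Relation.Comp R R') where
  step := by
    rintro s u ⟨t, hst, htu⟩ a s' hs
    obtain ⟨t₁, t', ht, hopt, hst₁, hst'⟩ := h.step hst hs
    obtain ⟨u₁, hu, htu₁⟩ := h'.tauSteps htu ht
    rcases hopt with hstep | ⟨rfl, rfl⟩
    · obtain ⟨u₂, u', hu', hopt', htu₂, htu'⟩ := h'.step htu₁ hstep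
      exact ⟨u₂, u', hu.trans hu', hopt', ⟨t₁, hst₁, htu₂⟩, ⟨t', hst', htu'⟩⟩
    · exact ⟨u₁, u₁, hu, .inr ⟨rfl, rfl⟩, ⟨t₁, hst₁, htu₁⟩, ⟨t₁, hst', htu₁⟩⟩
  final := by
    rintro s u ⟨t, hst, htu⟩ hs
    obtain ⟨t₁, ht, hst₁, hfin⟩ := h.final hst hs
    obtain ⟨u₁, hu, htu₁⟩ := h'.tauSteps htu ht
    obtain ⟨u₂, hu', htu₂, hfin'⟩ := h'.final htu₁ hfin
    exact ⟨u₂, hu.trans hu', ⟨t₁, hst₁, htu₂⟩, hfin'⟩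

end IsBranchingSimulation

theorem BranchingBisimilar.trans (h : BranchingBisimilar T₁ T₂) (h' : BranchingBisimilar T₂ T₃) :
    BranchingBisimilar T₁ T₃ := by
  rw [branchingBisimilar_iff] at *
  obtain ⟨R, hR, hR_flip, hinit⟩ := h
  obtain ⟨R', hR', hR'_flip, hinit'⟩ := h'
  refine ⟨Relation.Comp R R', hR.comp hR', ?_, T₂.init, hinit, hinit'⟩
  rw [Relation.flip_comp]
  exact hR'_flip.comp hR_flip

section Parallel

variable {K : Set C} {c : C} {d : Option D}

theorem not_communicatesOn_none : ¬ CommunicatesOn K (none : CommActionTau A C D) := by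
  rintro ⟨c, -, d, h | h⟩ <;> cases h

theorem communicatesOn_send (hc : c ∈ K) :
    CommunicatesOn K (some (.send c d) : CommActionTau A C D) :=
  ⟨c, hc, d, .inl rfl⟩

theorem communicatesOn_recv (hc : c ∈ K) :
    CommunicatesOn K (some (.recv c d) : CommActionTau A C D) :=
  ⟨c, hc, d, .inr rfl⟩

theorem TauSteps.parallel_right {t t' : T₂.State} (h : T₂.TauSteps t t') (s : T₁.State) :
    (parallel K T₁ T₂).TauSteps (s, t) (s, t') :=
  Relation.ReflTransGen.lift (Prod.mk s)
    (fun _ _ ht => ⟨not_communicatesOn_none, .inl (.inr ⟨ht, rfl⟩)⟩) _ _ h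

theorem IsBranchingSimulation.parallel_right (h : IsBranchingSimulation T₂ T₃ R')
    (K : Set C) (T₁ : TransitionSystem.{uA, uC, uD, v₁} A C D) :
    IsBranchingSimulation (parallel K T₁ T₂) (parallel K T₁ T₃)
      (fun x y => x.1 = y.1 ∧ R' x.2 y.2) where
  step := by
    rintro ⟨p, s⟩ ⟨_, t⟩ ⟨rfl, hst⟩ a ⟨p', s'⟩ ⟨hK, (⟨hp, rfl⟩ | ⟨hs, rfl⟩) | ⟨rfl, c, hc, d, hcd⟩⟩
    · exact ⟨(p, t), (p', t), .refl, .inl ⟨hK, .inl (.inl ⟨hp, rfl⟩)⟩, ⟨rfl, hst⟩, rfl, hst⟩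
    · obtain ⟨t₁, t', ht, hopt, hst₁, hst'⟩ := h.step hst hs
      refine ⟨(p, t₁), (p, t'), ht.parallel_right p, ?_, ⟨rfl, hst₁⟩, rfl, hst'⟩
      exact hopt.imp (fun ht' => ⟨hK, .inl (.inr ⟨ht', rfl⟩)⟩) (And.imp_right (congrArg _))
    · have synchronise {b : CommAction A C D} (hs : T₂.step s (some b) s')
          (hsync : ∀ t₁ t', T₃.step t₁ (some b) t' →
            (parallel K T₁ T₃).step (p, t₁) none (p', t')) :
          ∃ t₁ t', (parallel K T₁ T₃).TauSteps (p, t) t₁ ∧ (parallel K T₁ T₃).OptStep t₁ none t' ∧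
            (p = t₁.1 ∧ R' s t₁.2) ∧ p' = t'.1 ∧ R' s' t'.2 := by
        obtain ⟨t₁, t', ht, ht' | ⟨hb, -⟩, hst₁, hst'⟩ := h.step hst hs
        · exact ⟨(p, t₁), (p', t'), ht.parallel_right p, .inl (hsync _ _ ht'), ⟨rfl, hst₁⟩, rfl,
            hst'⟩
        · cases hb
      rcases hcd with ⟨hp, hs⟩ | ⟨hp, hs⟩
      · exact synchronise hs fun _ _ ht => ⟨hK, .inr ⟨rfl, c, hc, d, .inl ⟨hp, ht⟩⟩⟩
      · exact synchronise hs fun _ _ ht => ⟨hK, .inr ⟨rfl, c, hc, d, .inr ⟨hp, ht⟩⟩⟩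
  final := by
    rintro ⟨p, s⟩ ⟨_, t⟩ ⟨rfl, hst⟩ ⟨hp, hs⟩
    obtain ⟨t', ht, hst', hfin⟩ := h.final hst hs
    exact ⟨(p, t'), ht.parallel_right p, ⟨rfl, hst'⟩, hp, hfin⟩

theorem BranchingBisimilar.parallel_right (h : BranchingBisimilar T₂ T₃) (K : Set C)
    (T₁ : TransitionSystem.{uA, uC, uD, v₁} A C D) :
    BranchingBisimilar (parallel K T₁ T₂) (parallel K T₁ T₃) := by
  rw [branchingBisimilar_iff] at *
  obtain ⟨R, hR, hR_flip, hinit⟩ := h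
  refine ⟨_, hR.parallel_right K T₁, ?_, rfl, hinit⟩
  convert hR_flip.parallel_right K T₁ using 3
  exact and_congr_left' eq_comm

end Parallel

end TransitionSystem

/-! ### Receiving a word -/

namespace RTM

open TransitionSystem Turing

section SendWord

variable {A : Type uA} {C : Type uC} {D : Type uD} {u : C} {w : List D}

theorem move_right_write_blank {Γ : Type*} [Inhabited Γ] :
    ((Tape.mk₁ [] : Tape Γ).write default).move .right = Tape.mk₁ [] := by
  have hnil : (ListBlank.mk [default] : ListBlank Γ) = ListBlank.mk [] :=
    Quotient.sound' (.inr ⟨1, rfl⟩)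
  simpa [Tape.mk₁, Tape.mk₂, Tape.mk', Tape.write, Tape.move] using hnil

theorem sendWord_lts_step_iff {i : Fin (w.length + 1)} {a : CommActionTau A C D}
    {p : (sendWord A u w).lts.State} : (sendWord A u w).lts.step (i, Tape.mk₁ []) a p ↔
      ∃ j : Fin w.length,
        i = j.castSucc ∧ a = some (.send u (some (w.get j))) ∧ p = (j.succ, Tape.mk₁ []) := by
  obtain ⟨k, T⟩ := p
  constructor
  · rintro ⟨e, m, ⟨j, hj⟩, rfl⟩
    obtain ⟨rfl, -, rfl, rfl, rfl, rfl⟩ := by simpa only [Prod.mk.injEq] using hj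
    exact ⟨j, rfl, rfl, Prod.ext rfl move_right_write_blank⟩
  · rintro ⟨j, rfl, rfl, ⟨⟩⟩
    exact ⟨none, .right, ⟨j, rfl⟩, move_right_write_blank.symm⟩

end SendWord

end RTM

namespace TransitionSystem

open RTM Turing

variable {A : Type uA} {C : Type uC} {D : Type uD} {T : TransitionSystem.{uA, uC, uD, v} A C D}
  {u : C} {w : List D} {s s' t t₀ : T.State} {S : Set T.State}

theorem parallel_sendWord_step_iff {i : Fin (w.length + 1)} {a : CommActionTau A C D}
    {p : (sendWord A u w).lts.State} :
    (parallel {u} (sendWord A u w).lts T).step ((i, Tape.mk₁ []), s) a (p, s') ↔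
      (¬ CommunicatesOn {u} a ∧ T.step s a s' ∧ p = (i, Tape.mk₁ [])) ∨
      (a = none ∧ ∃ j : Fin w.length, i = j.castSucc ∧ p = (j.succ, Tape.mk₁ []) ∧
        T.step s (some (.recv u (some (w.get j)))) s') := by
  constructor
  · rintro ⟨hK, (⟨hp, -⟩ | ⟨hs, rfl⟩) | ⟨rfl, c, rfl, d, ⟨hp, hs⟩ | ⟨hp, -⟩⟩⟩
    · obtain ⟨j, -, rfl, -⟩ := sendWord_lts_step_iff.1 hp
      exact absurd (communicatesOn_send (Set.mem_singleton u)) hK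
    · exact .inl ⟨hK, hs, rfl⟩
    · obtain ⟨j, rfl, ⟨⟩, rfl⟩ := sendWord_lts_step_iff.1 hp
      exact .inr ⟨rfl, j, rfl, rfl, hs⟩
    · obtain ⟨j, -, ⟨⟩, -⟩ := sendWord_lts_step_iff.1 hp
  · rintro (⟨hK, hs, rfl⟩ | ⟨rfl, j, rfl, rfl, hs⟩)
    · exact ⟨hK, .inl (.inr ⟨hs, rfl⟩)⟩
    · exact ⟨not_communicatesOn_none, .inr ⟨rfl, u, rfl, _,
        .inl ⟨sendWord_lts_step_iff.2 ⟨j, rfl, rfl, rfl⟩, hs⟩⟩⟩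

/-- `T.Receives u s w t`: from `s`, the system can receive the word `w` along channel `u` and is
then in `t`; before that, it can do nothing but receive along `u`, and each symbol of `w` leaves it
no choice. -/
inductive Receives (T : TransitionSystem.{uA, uC, uD, v} A C D) (u : C) :
    T.State → List D → T.State → Prop
  | nil (t : T.State) : T.Receives u t [] t
  | cons {s s' t : T.State} {d : D} {w : List D}
      (hstep : T.step s (some (.recv u (some d))) s')
      (honly : ∀ a s'', T.step s a s'' →
        ∃ e, a = some (.recv u e) ∧ (e = some d → s'' = s'))
      (hreceives : T.Receives u s' w t) : T.Receives u s (d :: w) t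

theorem Receives.tauSteps {i : Fin (w.length + 1)} (h : T.Receives u s (w.drop i) t) :
    (parallel {u} (sendWord A u w).lts T).TauSteps
      ((i, Tape.mk₁ []), s) ((Fin.last w.length, Tape.mk₁ []), t) := by
  induction i using Fin.reverseInduction generalizing s with
  | last =>
    rw [Fin.val_last, List.drop_length] at h
    cases h
    exact .refl
  | cast j ih =>
    rw [Fin.val_castSucc, List.drop_eq_getElem_cons j.2] at h
    obtain _ | ⟨hstep, -, hreceives⟩ := h
    exact .head (parallel_sendWord_step_iff.2 (.inr ⟨rfl, j, rfl, rfl, hstep⟩)) (ih hreceives)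

/-- The relation between a system `T` that starts in `t₀` and a sender of `w` composed with a copy
of `T` that is in `t₀` after receiving `w`; afterwards `T` stays within `S`. -/
inductive AfterReceipt (T : TransitionSystem.{uA, uC, uD, v} A C D) (u : C) (w : List D)
    (t₀ : T.State) (S : Set T.State) :
    T.State → (parallel {u} (sendWord A u w).lts T).State → Prop
  | pending {s : T.State} (i : Fin (w.length + 1)) (h : T.Receives u s (w.drop i) t₀) :
      AfterReceipt T u w t₀ S t₀ ((i, Tape.mk₁ []), s)
  | done {t : T.State} (ht : t ∈ S) :
      AfterReceipt T u w t₀ S t ((Fin.last w.length, Tape.mk₁ []), t)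

namespace AfterReceipt

variable {x x' : (parallel {u} (sendWord A u w).lts T).State}

theorem tauSteps (h : AfterReceipt T u w t₀ S t x) (ht₀ : t₀ ∈ S) :
    t ∈ S ∧ (parallel {u} (sendWord A u w).lts T).TauSteps x
      ((Fin.last w.length, Tape.mk₁ []), t) := by
  cases h with
  | pending i h => exact ⟨ht₀, h.tauSteps⟩
  | done ht => exact ⟨ht, .refl⟩

theorem step_of_done (hS : ∀ t ∈ S, ∀ a t', T.step t a t' → ¬ CommunicatesOn {u} a ∧ t' ∈ S)
    (ht : t ∈ S) {a : CommActionTau A C D}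
    (hx : (parallel {u} (sendWord A u w).lts T).step
      ((Fin.last w.length, Tape.mk₁ []), t) a x') :
    ∃ t', T.step t a t' ∧ AfterReceipt T u w t₀ S t' x' := by
  obtain ⟨p, t'⟩ := x'
  obtain ⟨-, ht', rfl⟩ | ⟨-, j, hj, -⟩ := parallel_sendWord_step_iff.1 hx
  · exact ⟨t', ht', .done (hS t ht a t' ht').2⟩
  · exact absurd hj.symm (Fin.castSucc_ne_last j)

theorem step_right (hS : ∀ t ∈ S, ∀ a t', T.step t a t' → ¬ CommunicatesOn {u} a ∧ t' ∈ S)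
    (ht₀ : t₀ ∈ S) (h : AfterReceipt T u w t₀ S t x) {a : CommActionTau A C D}
    (hx : (parallel {u} (sendWord A u w).lts T).step x a x') :
    ∃ t', T.OptStep t a t' ∧ AfterReceipt T u w t₀ S t' x' := by
  cases h with
  | done ht =>
    obtain ⟨t', ht', h'⟩ := step_of_done hS ht hx
    exact ⟨t', .inl ht', h'⟩
  | pending i h =>
    obtain ⟨p, s'⟩ := x'
    cases i using Fin.lastCases with
    | last =>
      rw [Fin.val_last, List.drop_length] at h
      cases h
      obtain ⟨t', ht', h'⟩ := step_of_done hS ht₀ hx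
      exact ⟨t', .inl ht', h'⟩
    | cast j =>
      rw [Fin.val_castSucc, List.drop_eq_getElem_cons j.2] at h
      obtain _ | ⟨-, honly, hreceives⟩ := h
      obtain ⟨hK, hs, -⟩ | ⟨rfl, k, hk, rfl, hs⟩ := parallel_sendWord_step_iff.1 hx
      · obtain ⟨e, rfl, -⟩ := honly _ _ hs
        exact absurd (communicatesOn_recv (Set.mem_singleton u)) hK
      · obtain rfl := Fin.castSucc_injective _ hk
        obtain ⟨e, ⟨⟩, he⟩ := honly _ _ hs
        obtain rfl := he rfl
        exact ⟨_, .inr ⟨rfl, rfl⟩, .pending j.succ hreceives⟩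

theorem mem_final (h : AfterReceipt T u w t₀ S t x)
    (hx : x ∈ (parallel {u} (sendWord A u w).lts T).final) : t ∈ T.final := by
  cases h with
  | done ht => exact hx.2
  | pending i h =>
    obtain rfl : i = Fin.last w.length := hx.1
    rw [Fin.val_last, List.drop_length] at h
    cases h
    exact hx.2

end AfterReceipt

theorem Receives.branchingBisimilar (h : T.Receives u T.init w t₀) (ht₀ : t₀ ∈ S)
    (hS : ∀ t ∈ S, ∀ a t', T.step t a t' → ¬ CommunicatesOn {u} a ∧ t' ∈ S) :
    BranchingBisimilar { T with init := t₀ } (parallel {u} (sendWord A u w).lts T) := by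
  refine branchingBisimilar_iff.2 ⟨AfterReceipt T u w t₀ S, ⟨?_, ?_⟩,
    .of_optStep (fun h => h.step_right hS ht₀) (fun h => h.mem_final), .pending 0 h⟩
  · intro t x h a t' hstep
    obtain ⟨ht, hx⟩ := h.tauSteps ht₀
    obtain ⟨ha, ht'⟩ := hS t ht a t' hstep
    exact ⟨_, (_, _), hx, .inl (parallel_sendWord_step_iff.2 (.inl ⟨ha, hstep, rfl⟩)),
      .done ht, .done ht'⟩
  · intro t x h hfin
    obtain ⟨ht, hx⟩ := h.tauSteps ht₀
    exact ⟨_, hx, .done ht, rfl, hfin⟩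

end TransitionSystem

/-! ### Routines on a tape -/

/-- A finite deterministic program that inspects and modifies a two-way infinite tape by the
instructions of Post machines. It halts where `next` is undefined; its output then depends on the
state only. -/
structure Routine (Γ β : Type) where
  State : Type
  finite_state : Finite State
  next : State → Γ → Option (State × Turing.TM0.Stmt Γ)
  start : State
  out : State → β

namespace Routine

open Turing

variable {Γ β γ : Type} [Inhabited Γ]

/-- The effect of an instruction on the tape. -/
def effect : TM0.Stmt Γ → Tape Γ → Tape Γ
  | .move d, T => T.move d
  | .write a, T => T.write a

/-- `P.HaltsWith q T T' b`: from state `q` and tape `T`, the program halts with tape `T'` and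
output `b`. -/
inductive HaltsWith (P : Routine Γ β) : P.State → Tape Γ → Tape Γ → β → Prop
  | halt {q : P.State} {T : Tape Γ} (h : P.next q T.head = none) : HaltsWith P q T T (P.out q)
  | step {q q' : P.State} {s : TM0.Stmt Γ} {T T' : Tape Γ} {b : β}
      (h : P.next q T.head = some (q', s)) (h' : HaltsWith P q' (effect s T) T' b) :
      HaltsWith P q T T' b

/-- `P.Runs T T' b`: started on the tape `T`, the program halts with tape `T'` and output `b`. -/
def Runs (P : Routine Γ β) (T T' : Tape Γ) (b : β) : Prop :=
  P.HaltsWith P.start T T' b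

section HaltsWith

variable {P : Routine Γ β} {q q' : P.State} {s : TM0.Stmt Γ} {T T' : Tape Γ} {b : β}

theorem HaltsWith.of_next_eq_some (h : P.HaltsWith q T T' b)
    (hnext : P.next q T.head = some (q', s)) : P.HaltsWith q' (effect s T) T' b := by
  cases h with
  | halt h => simp [h] at hnext
  | step h h' =>
    obtain ⟨⟩ := h.symm.trans hnext
    exact h'

theorem HaltsWith.of_next_eq_none (h : P.HaltsWith q T T' b) (hnext : P.next q T.head = none) :
    T' = T ∧ P.out q = b := by
  cases h with
  | halt => exact ⟨rfl, rfl⟩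
  | step h => simp [h] at hnext

end HaltsWith

/-- Run `P`, then the program selected by its output. -/
def bind [Finite β] (P : Routine Γ β) (K : β → Routine Γ γ) : Routine Γ γ where
  State := P.State ⊕ Σ b, (K b).State
  finite_state :=
    haveI := P.finite_state
    haveI := fun b => (K b).finite_state
    inferInstance
  next
    | .inl q, a => match P.next q a with
      | some (q', s) => some (.inl q', s)
      | none => some (.inr ⟨P.out q, (K (P.out q)).start⟩, .write a)
    | .inr ⟨b, q⟩, a => ((K b).next q a).map (Prod.map (fun q' => .inr ⟨b, q'⟩) id)
  start := .inl P.start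
  out
    | .inl q => (K (P.out q)).out (K (P.out q)).start
    | .inr ⟨b, q⟩ => (K b).out q

theorem HaltsWith.bind_inr [Finite β] (P : Routine Γ β) {K : β → Routine Γ γ} {b : β}
    {q : (K b).State} {T T' : Tape Γ} {c : γ} (h : (K b).HaltsWith q T T' c) :
    (P.bind K).HaltsWith (.inr ⟨b, q⟩) T T' c := by
  induction h with
  | halt h => exact .halt (by simp only [bind, h, Option.map_none])
  | step h _ ih => exact .step (by simp only [bind, h, Option.map_some]; rfl) ih

theorem HaltsWith.bind_inl [Finite β] {P : Routine Γ β} {K : β → Routine Γ γ} {q : P.State}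
    {T T' T'' : Tape Γ} {b : β} {c : γ} (h : P.HaltsWith q T T' b) (h' : (K b).Runs T' T'' c) :
    (P.bind K).HaltsWith (.inl q) T T'' c := by
  induction h with
  | @halt q T h =>
    refine .step (P := P.bind K) (q' := .inr ⟨P.out q, (K (P.out q)).start⟩) (s := .write T.head)
      (by simp only [bind, h]) ?_
    rw [effect, Tape.write_self]
    exact h'.bind_inr P
  | @step q q' s _ _ _ h _ ih =>
    exact .step (P := P.bind K) (q' := .inl q') (s := s) (by simp only [bind, h]) (ih h')

theorem Runs.bind [Finite β] {P : Routine Γ β} {K : β → Routine Γ γ} {T T' T'' : Tape Γ} {b : β}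
    {c : γ} (hP : P.Runs T T' b) (hK : (K b).Runs T' T'' c) : (P.bind K).Runs T T'' c :=
  HaltsWith.bind_inl hP hK

/-- Apply `f` to the output. -/
def mapOut (P : Routine Γ β) (f : β → γ) : Routine Γ γ :=
  { P with out := fun q => f (P.out q) }

theorem HaltsWith.mapOut {P : Routine Γ β} {q : P.State} {T T' : Tape Γ} {b : β}
    (h : P.HaltsWith q T T' b) (f : β → γ) : (P.mapOut f).HaltsWith q T T' (f b) := by
  induction h with
  | halt h => exact .halt (P := P.mapOut f) h
  | step h _ ih => exact .step (P := P.mapOut f) h ih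

theorem Runs.mapOut {P : Routine Γ β} {T T' : Tape Γ} {b : β} (h : P.Runs T T' b) (f : β → γ) :
    (P.mapOut f).Runs T T' (f b) :=
  HaltsWith.mapOut h f

/-- Perform one instruction. -/
def exec (s : TM0.Stmt Γ) : Routine Γ Unit where
  State := Bool
  finite_state := inferInstance
  next done _ := cond done none (some (true, s))
  start := false
  out _ := ()

theorem runs_exec (s : TM0.Stmt Γ) (T : Tape Γ) : (exec s).Runs T (effect s T) () :=
  .step (P := exec s) rfl (.halt (P := exec s) (q := true) rfl)

/-- Output the scanned symbol. -/
def read (Γ : Type) [Inhabited Γ] [Finite Γ] : Routine Γ Γ where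
  State := Option Γ
  finite_state := inferInstance
  next q a := q.elim (some (some a, .write a)) fun _ => none
  start := none
  out q := q.getD default

theorem runs_read [Finite Γ] (T : Tape Γ) : (read Γ).Runs T T T.head := by
  refine .step (P := read Γ) rfl ?_
  rw [effect, Tape.write_self]
  exact .halt (P := read Γ) (q := some T.head) rfl

/-- Output the symbol `p` cells to the right of the head. -/
def readAt (Γ : Type) [Inhabited Γ] [Finite Γ] : ℕ → Routine Γ Γ
  | 0 => read Γ
  | p + 1 => (exec (.move .right)).bind fun _ => (readAt Γ p).bind fun a =>
      (exec (.move .left)).mapOut fun _ => a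

theorem runs_readAt [Finite Γ] (p : ℕ) (T : Tape Γ) : (readAt Γ p).Runs T T (T.nth p) := by
  induction p generalizing T with
  | zero => exact runs_read T
  | succ p ih =>
    refine (runs_exec _ T).bind ((ih _).bind ?_)
    have hleft := (runs_exec (.move .left) (T.move .right)).mapOut fun _ => T.nth ↑(p + 1)
    rw [effect, Tape.move_right_left] at hleft
    simpa only [effect, Tape.move_right_nth, Nat.cast_succ] using hleft

/-- Write a word to the right of the head, and return to its first symbol. -/
def writeWord : List Γ → Routine Γ Unit
  | [] => exec (.write default)
  | a :: w => (exec (.write a)).bind fun _ => (exec (.move .right)).bind fun _ =>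
      (writeWord w).bind fun _ => exec (.move .left)

theorem runs_writeWord (w : List Γ) (L : ListBlank Γ) :
    (writeWord w).Runs (Tape.mk' L (ListBlank.mk [])) (Tape.mk' L (ListBlank.mk w)) () := by
  induction w generalizing L with
  | nil =>
    have h := runs_exec (.write default) (Tape.mk' L (ListBlank.mk []))
    have hhead : (Tape.mk' L (ListBlank.mk [])).head = default := rfl
    rwa [effect, ← hhead, Tape.write_self] at h
  | cons a w ih =>
    have hright : effect (.move .right) (effect (.write a) (Tape.mk' L (ListBlank.mk [])))
        = Tape.mk' (L.cons a) (ListBlank.mk []) := by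
      simp [effect, Tape.mk', Tape.write, Tape.move]
    refine (runs_exec _ _).bind ((runs_exec _ _).bind (.bind (hright ▸ ih _) ?_))
    have h := runs_exec (.move .left) (Tape.mk' (L.cons a) (ListBlank.mk w))
    rwa [effect, Tape.move_left_mk', ListBlank.head_cons, ListBlank.tail_cons,
      ListBlank.cons_mk] at h

/-- The restriction of a Turing machine to a finite set of states that supports it. -/
def ofTM0 {Λ : Type} [Inhabited Λ] (M : TM0.Machine Γ Λ) (S : Set Λ) [Finite S]
    (hS : TM0.Supports M S) : Routine Γ Unit where
  State := S
  finite_state := inferInstance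
  next q a := (M q a).pmap (fun r hr => (⟨r.1, hr⟩, r.2)) fun _ hr => hS.2 hr q.2
  start := ⟨default, hS.1⟩
  out _ := ()

theorem haltsWith_ofTM0 {Λ : Type} [Inhabited Λ] {M : TM0.Machine Γ Λ} {S : Set Λ} [Finite S]
    (hS : TM0.Supports M S) {x c : TM0.Cfg Γ Λ} (hx : x.q ∈ S)
    (hc : c ∈ StateTransition.eval (TM0.step M) x) :
    (ofTM0 M S hS).HaltsWith ⟨x.q, hx⟩ x.Tape c.Tape () := by
  obtain ⟨hreaches, hhalt⟩ := StateTransition.mem_eval.1 hc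
  clear hc
  induction hreaches using Relation.ReflTransGen.head_induction_on with
  | refl =>
    have hnext : M c.q c.Tape.head = none := by simpa [TM0.step] using hhalt
    exact .halt (P := ofTM0 M S hS) (by simp [ofTM0, hnext])
  | @head x y hxy _ ih =>
    obtain ⟨⟨q, s⟩, hnext, rfl⟩ := Option.map_eq_some_iff.1 hxy
    refine .step (P := ofTM0 M S hS) (q' := ⟨q, hS.2 hnext hx⟩) (s := s) (by simp [ofTM0, hnext]) ?_
    convert ih (hS.2 hnext hx) using 1
    cases s <;> rfl

theorem runs_ofTM0 {Λ : Type} [Inhabited Λ] {M : TM0.Machine Γ Λ} {S : Set Λ} [Finite S]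
    (hS : TM0.Supports M S) {T : Tape Γ} {c : TM0.Cfg Γ Λ}
    (hc : c ∈ StateTransition.eval (TM0.step M) ⟨default, T⟩) : (ofTM0 M S hS).Runs T c.Tape () :=
  haltsWith_ofTM0 hS (x := ⟨default, T⟩) hS.1 hc

end Routine

/-! ### Data on a tape of bits -/

namespace Routine

open Turing

/-- The symbols of the tape that carries the four stacks of `Turing.PartrecToTM2`. -/
abbrev StackSymbol : Type := TM2to1.Γ' PartrecToTM2.K' fun _ => PartrecToTM2.Γ'

instance instFintypeStackIndex : Fintype PartrecToTM2.K' :=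
  ⟨{.main, .rev, .aux, .stack}, by rintro ⟨⟩ <;> simp⟩

/-- A column of the tape of stacks in which only the main stack holds a symbol. -/
def mainColumn (a : PartrecToTM2.Γ') : PartrecToTM2.K' → Option PartrecToTM2.Γ' :=
  Function.update (fun _ => none) .main (some a)

/-- The symbol of a column in which only the main stack holds a symbol; `bottom` marks the column
that contains the bottoms of the stacks. -/
def columnSymbol (bottom : Bool) (a : PartrecToTM2.Γ') : StackSymbol :=
  (bottom, mainColumn a)

/-- The tape of stacks whose main stack holds the list `v`. Bottoms of stacks come first. -/
def listColumns (v : List ℕ) : ListBlank (PartrecToTM2.K' → Option PartrecToTM2.Γ') :=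
  ListBlank.mk ((PartrecToTM2.trList v).reverse.map mainColumn)

theorem listColumns_map_proj (v : List ℕ) (k : PartrecToTM2.K') :
    (listColumns v).map (proj k) = ListBlank.mk
      (((PartrecToTM2.K'.elim (PartrecToTM2.trList v) [] [] [] k).map some).reverse) := by
  refine ListBlank.ext fun i => ?_
  rw [listColumns, ListBlank.map_mk, ListBlank.nth_mk, ListBlank.nth_mk,
    List.getI_eq_getElem?_getD, List.getI_eq_getElem?_getD, List.map_map, ← List.map_reverse,
    List.getElem?_map, List.getElem?_map]
  cases k <;> simp only [PartrecToTM2.K'.elim] <;>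
    cases (PartrecToTM2.trList v).reverse[i]? <;> rfl

section Tape

variable {n : ℕ} {enc : StackSymbol → List.Vector Bool n} {dec : List.Vector Bool n → StackSymbol}
  (enc0 : enc default = List.Vector.replicate n false)

/-- The tape of bits on which Turing machines obtained from `Turing.PartrecToTM2` find or leave the
list `v`. -/
def listTape (v : List ℕ) : Tape Bool :=
  TM1to1.trTape enc0 (Tape.mk' ∅ (TM2to1.addBottom (listColumns v)))

theorem trCfg_halt {w : List ℕ} {x} (hx : TM2to1.TrCfg (PartrecToTM2.halt w) x) :
    x.Tape = Tape.mk' ∅ (TM2to1.addBottom (listColumns w)) := by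
  generalize hd : PartrecToTM2.halt w = d at hx
  obtain ⟨L, hL⟩ := hx
  have : L = listColumns w := by
    refine ListBlank.ext fun i => funext fun k => ?_
    rw [← proj_map_nth, ← proj_map_nth, hL, listColumns_map_proj]
    cases hd
    rfl
  rw [this]

theorem exists_runs_of_code (encdec : ∀ a, dec (enc a) = a) (c : ToPartrec.Code) :
    ∃ P : Routine Bool Unit, ∀ v w, w ∈ c.eval v →
      P.Runs (listTape enc0 v) (listTape enc0 w) () := by
  let _ : Inhabited PartrecToTM2.Λ' := ⟨PartrecToTM2.trNormal c .halt⟩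
  have hsupp := TM1to0.tr_supports _ <| TM1to1.tr_supports (enc := enc) (dec := dec) _ <|
    TM2to1.tr_supports _ <| PartrecToTM2.tr_supports c .halt
  refine ⟨ofTM0 _ _ hsupp, fun v w hw => ?_⟩
  have heval : PartrecToTM2.halt w ∈
      StateTransition.eval (TM2.step PartrecToTM2.tr) (PartrecToTM2.init c v) := by
    rw [PartrecToTM2.tr_eval]
    exact Part.mem_map _ hw
  obtain ⟨x₁, hx₁, heval₁⟩ := StateTransition.tr_eval (TM2to1.tr_respects PartrecToTM2.tr)
    (TM2to1.TrCfg.mk (listColumns v) (listColumns_map_proj v)) heval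
  obtain ⟨x₂, rfl, heval₂⟩ := StateTransition.tr_eval
    (TM1to1.tr_respects (enc0 := enc0) dec _ encdec) rfl heval₁
  obtain ⟨x₃, rfl, heval₃⟩ := StateTransition.tr_eval (TM1to0.tr_respects _) rfl heval₂
  have htape : (TM1to0.trCfg (TM1to1.tr enc dec (TM2to1.tr PartrecToTM2.tr))
      (TM1to1.trCfg enc enc0 x₁)).Tape = listTape enc0 w := by
    rw [listTape, ← trCfg_halt hx₁]
    rfl
  exact htape ▸ runs_ofTM0 hsupp heval₃

theorem exists_listTape_nil :
    ∃ w, listTape enc0 [] = Tape.mk' (ListBlank.mk []) (ListBlank.mk w) := by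
  refine ⟨(enc (true, fun _ => none)).toList ++ [], ?_⟩
  have hbottom : TM2to1.addBottom (listColumns []) =
    ListBlank.mk (Γ := StackSymbol) [(true, fun _ => none)] := rfl
  rw [listTape, TM1to1.trTape_mk', TM1to1.trTape', hbottom, ListBlank.flatMap_mk]
  rfl

theorem listTape_nth_second_column {v : List ℕ} {a b : PartrecToTM2.Γ'} {l : List PartrecToTM2.Γ'}
    (hv : (PartrecToTM2.trList v).reverse = a :: b :: l) (i : Fin n) :
    (listTape enc0 v).nth (n + i : ℕ) = (enc (columnSymbol false b)).get i := by
  have hbottom :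
      TM2to1.addBottom (ListBlank.mk (mainColumn a :: mainColumn b :: l.map mainColumn)) =
      ListBlank.mk (Γ := StackSymbol)
        (columnSymbol true a :: columnSymbol false b ::
          (l.map mainColumn).map fun c => ((false, c) : StackSymbol)) := rfl
  rw [listTape, TM1to1.trTape_mk', TM1to1.trTape', Tape.mk'_nth_nat, listColumns, hv, List.map_cons,
    List.map_cons, hbottom, ListBlank.flatMap_mk, ListBlank.nth_mk, List.flatMap_cons,
    List.flatMap_cons, List.getI_append_right _ _ _ (by simp), List.getI_append _ _ _ (by simp)]
  simp only [List.Vector.toList_length, Nat.add_sub_cancel_left]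
  rw [List.getI_eq_getElem _ (by simp), List.Vector.get_eq_get_toList]
  rfl

end Tape

section Data

open Encodable

variable {α : Type*} [Primcodable α]

/-- The list of numbers that represents a datum together with a flag. As lists are stored from the
right to the left, the flag comes last in order to have a fixed position on the tape. -/
def flaggedList (y : Bool × α) : List ℕ :=
  [encode y.2, encode y.1]

theorem exists_code_flaggedList {k : ℕ} {f : List.Vector ℕ k → Option (Bool × α)}
    (hf : Computable f) :
    ∃ c : ToPartrec.Code, ∀ v y, f v = some y → c.eval v.1 = pure (flaggedList y) := by
  have exists_code {g : Bool × α → ℕ} (hg : Computable g) :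
      ∃ c : ToPartrec.Code, ∀ v y, f v = some y → c.eval v.1 = pure [g y] := by
    have h : Computable fun v => ((f v).map g).getD 0 :=
      .option_getD (.option_map hf (hg.comp .snd).to₂) (.const 0)
    obtain ⟨c, hc⟩ := ToPartrec.Code.exists_code (Nat.Partrec'.part_iff.2 h)
    refine ⟨c, fun v y hy => (hc v).trans ?_⟩
    simp [hy]
  obtain ⟨c₁, h₁⟩ := exists_code (Computable.encode.comp .snd)
  obtain ⟨c₂, h₂⟩ := exists_code (Computable.encode.comp .fst)
  refine ⟨.cons c₁ c₂, fun v y hy => ?_⟩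
  simp [h₁ v y hy, h₂ v y hy, flaggedList]

variable {n : ℕ} {enc : StackSymbol → List.Vector Bool n}
  (enc0 : enc default = List.Vector.replicate n false)

theorem exists_readAt_flag (hinj : Function.Injective enc) :
    ∃ (p : ℕ) (g : Bool → Bool),
      ∀ y : Bool × α, g ((listTape enc0 (flaggedList y)).nth p) = y.1 := by
  have hne : enc (columnSymbol false .cons) ≠ enc (columnSymbol false .bit1) := fun h => by
    simpa [columnSymbol, mainColumn] using
      congrFun (congrArg Prod.snd (hinj h)) PartrecToTM2.K'.main
  obtain ⟨i, hi⟩ : ∃ i : Fin n, (enc (columnSymbol false .cons)).get i ≠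
      (enc (columnSymbol false .bit1)).get i := by
    by_contra! h
    exact hne (List.Vector.ext h)
  refine ⟨n + i, fun b => b == (enc (columnSymbol false .bit1)).get i, ?_⟩
  rintro ⟨_ | _, x⟩
  · rw [listTape_nth_second_column enc0 (a := .cons) (b := .cons)
      (l := (PartrecToTM2.trNat (encode x)).reverse) (by simp [flaggedList])]
    simpa using hi
  · rw [listTape_nth_second_column enc0 (a := .cons) (b := .bit1)
      (l := .cons :: (PartrecToTM2.trNat (encode x)).reverse)
      (by simp [flaggedList, show PartrecToTM2.trNat 1 = [.bit1] from rfl])]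
    simp

theorem exists_encoding (α : Type*) [Primcodable α] : ∃ rep : Bool × α → Tape Bool,
    (∀ y, ∃ P : Routine Bool Bool, P.Runs (Tape.mk₁ []) (rep y) y.1) ∧
    ∀ f : α → Bool × α, Computable f →
      ∃ P : Routine Bool Bool, ∀ y, P.Runs (rep y) (rep (f y.2)) (f y.2).1 := by
  obtain ⟨n, enc, dec, enc0, encdec⟩ := TM1to1.exists_enc_dec (Γ := StackSymbol)
  obtain ⟨p, g, hflag⟩ := exists_readAt_flag (α := α) enc0 (Function.LeftInverse.injective encdec)
  have exists_runs {k : ℕ} {f : List.Vector ℕ k → Option (Bool × α)} (hf : Computable f) :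
      ∃ P : Routine Bool Bool, ∀ v y, f v = some y →
        P.Runs (listTape enc0 v.1) (listTape enc0 (flaggedList y)) y.1 := by
    obtain ⟨c, hc⟩ := exists_code_flaggedList hf
    obtain ⟨P, hP⟩ := exists_runs_of_code enc0 encdec c
    refine ⟨P.bind fun _ => (readAt Bool p).mapOut g, fun v y hy => ?_⟩
    refine (hP _ (flaggedList y) (by rw [hc v y hy]; exact Part.mem_some _)).bind ?_
    exact hflag y ▸ (runs_readAt p _).mapOut g
  refine ⟨fun y => listTape enc0 (flaggedList y), fun y => ?_, fun f hf => ?_⟩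
  · obtain ⟨w, hw⟩ := exists_listTape_nil enc0
    obtain ⟨P, hP⟩ := exists_runs (k := 0) (f := fun _ => some y) (.const _)
    exact ⟨(writeWord w).bind fun _ => P, (runs_writeWord w _).bind (hw ▸ hP .nil y rfl)⟩
  · obtain ⟨P, hP⟩ := exists_runs (k := 2) (f := fun v => (decode v.head).map f)
      (.option_map (Computable.decode.comp Primrec.vector_head.to_comp) (hf.comp .snd).to₂)
    exact ⟨P, fun y => hP ⟨flaggedList y, rfl⟩ _ (by simp [flaggedList, List.Vector.head])⟩

end Data

end Routine

/-! ### Machines on data -/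

/-- A rule of a machine with control states in `σ` and a datum in `α`: in the control state
`source`, provided that the outcome of the test belongs to `guard`, the machine may execute
`action`, apply `update` to its datum and go to the control state `target`. -/
structure DataMachine.Rule (A : Type uA) (C : Type uC) (D : Type uD) (σ : Type) (α : Type*) where
  source : σ
  guard : Set Bool
  action : CommActionTau A C D
  update : α → α
  target : σ

/-- A machine with a single datum, which it inspects and modifies by means of computable functions.
All that a rule can depend on is the control state and the outcome of the test in that state. -/
structure DataMachine (A : Type uA) (C : Type uC) (D : Type uD) (α : Type*) [Primcodable α] where
  State : Type
  Index : Type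
  finite_index : Finite Index
  rule : Index → DataMachine.Rule A C D State α
  computable_update : ∀ i, Computable (rule i).update
  test : State → α → Bool
  computable_test : ∀ s, Computable (test s)
  final : Set State

namespace DataMachine

open TransitionSystem Turing

variable {A : Type uA} {C : Type uC} {D : Type uD} {α : Type*} [Primcodable α]

/-- The transition system of a machine on data that starts in `c₀`. -/
def lts (N : DataMachine A C D α) (c₀ : N.State × α) : TransitionSystem A C D where
  State := N.State × α
  step c a c' := ∃ i, (N.rule i).source = c.1 ∧ N.test c.1 c.2 ∈ (N.rule i).guard ∧
    (N.rule i).action = a ∧ c' = ((N.rule i).target, (N.rule i).update c.2)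
  init := c₀
  final := {c | c.1 ∈ N.final}

section Realisation

variable {Γ : Type} [Inhabited Γ] (N : DataMachine A C D α) (s₀ : N.State)
  (P : Option N.Index → Routine Γ Bool) (sym : PointedMap Γ (Option D))

/-- The control state after the last rule executed, where `none` stands for no rule at all. -/
def stateAfter : Option N.Index → N.State
  | none => s₀
  | some i => (N.rule i).target

/-- The outcome of the test, together with the datum. -/
def flagged (c : N.State × α) : Bool × α :=
  (N.test c.1 c.2, c.2)

/-- The control states of the reactive Turing machine that realises a machine on data: the rule that
is being executed, the state of its routine, and whether the head is one cell to the right of the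
head of the routine. Such a displacement arises because reactive Turing machines cannot write
without moving. -/
abbrev RealState : Type := Σ r : Option N.Index, (P r).State × Bool

/-- The transitions of the reactive Turing machine that realises a machine on data. -/
inductive RealRel : RealState N P → Option D → CommActionTau A C D → Option D → Dir →
    RealState N P → Prop
  | move {r : Option N.Index} {q q' : (P r).State} {a : Γ} {d : Dir}
      (h : (P r).next q a = some (q', .move d)) :
      RealRel ⟨r, q, false⟩ (sym a) none (sym a) d ⟨r, q', false⟩
  | write {r : Option N.Index} {q q' : (P r).State} {a b : Γ}
      (h : (P r).next q a = some (q', .write b)) :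
      RealRel ⟨r, q, false⟩ (sym a) none (sym b) .right ⟨r, q', true⟩
  | fire {r : Option N.Index} {q : (P r).State} {a : Γ} (h : (P r).next q a = none) {i : N.Index}
      (hsource : (N.rule i).source = N.stateAfter s₀ r) (hguard : (P r).out q ∈ (N.rule i).guard) :
      RealRel ⟨r, q, false⟩ (sym a) (N.rule i).action (sym a) .right
        ⟨some i, (P (some i)).start, true⟩
  | back {r : Option N.Index} {q : (P r).State} (d : Option D) :
      RealRel ⟨r, q, true⟩ d none d .left ⟨r, q, false⟩

/-- The reactive Turing machine that realises a machine on data by means of given routines. -/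
def realize : RTM A C D where
  State := RealState N P
  finite_state :=
    haveI := N.finite_index
    haveI := fun r => (P r).finite_state
    inferInstance
  rel := {(s, d, a, e, m, t) | RealRel N s₀ P sym s d a e m t}
  init := ⟨none, (P none).start, false⟩
  final := {s | N.stateAfter s₀ s.1 ∈ N.final}

variable {N s₀ P sym}

theorem realize_step_iff {c c' : (N.realize s₀ P sym).lts.State} {a : CommActionTau A C D} :
    (N.realize s₀ P sym).lts.step c a c' ↔ ∃ e m,
      RealRel N s₀ P sym c.1 c.2.head a e m c'.1 ∧ c'.2 = (c.2.write e).move m :=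
  Iff.rfl

theorem realize_step_map {c c' : RealState N P} {T : Tape Γ} {b : Γ} {a : CommActionTau A C D}
    {m : Dir} (h : RealRel N s₀ P sym c (sym T.head) a (sym b) m c') :
    (N.realize s₀ P sym).lts.step (c, T.map sym) a (c', ((T.write b).move m).map sym) :=
  realize_step_iff.2 ⟨_, _, by rwa [Tape.map_fst], by rw [Tape.map_move, Tape.map_write]⟩

theorem realize_step_back (r : Option N.Index) (q : (P r).State) (T : Tape (Option D)) :
    (N.realize s₀ P sym).lts.step (⟨r, q, true⟩, T.move .right) none (⟨r, q, false⟩, T) :=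
  realize_step_iff.2 ⟨_, _, .back _, by rw [Tape.write_self, Tape.move_right_left]⟩

theorem realize_tauSteps_next {r : Option N.Index} {q q' : (P r).State} {T : Tape Γ}
    {s : TM0.Stmt Γ} (h : (P r).next q T.head = some (q', s)) :
    (N.realize s₀ P sym).lts.TauSteps (⟨r, q, false⟩, T.map sym)
      (⟨r, q', false⟩, (Routine.effect s T).map sym) := by
  cases s with
  | move d =>
    have hmove := realize_step_map (s₀ := s₀) (sym := sym) (.move h)
    rw [Tape.write_self] at hmove
    exact .single hmove
  | write b =>
    have hback := realize_step_back (s₀ := s₀) (sym := sym) r q' ((T.write b).map sym)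
    rw [← Tape.map_move] at hback
    exact .head (realize_step_map (.write h)) (.single hback)

theorem realize_tauSteps {r : Option N.Index} {q : (P r).State} {T T' : Tape Γ} {b : Bool}
    (h : (P r).HaltsWith q T T' b) :
    ∃ q', (P r).HaltsWith q' T' T' b ∧ (P r).next q' T'.head = none ∧ (P r).out q' = b ∧
      (N.realize s₀ P sym).lts.TauSteps (⟨r, q, false⟩, T.map sym)
        (⟨r, q', false⟩, T'.map sym) := by
  induction h with
  | halt h => exact ⟨_, .halt h, h, rfl, .refl⟩
  | step h _ ih =>
    obtain ⟨q', hhalt, hnext, hout, hτ⟩ := ih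
    exact ⟨q', hhalt, hnext, hout, (realize_tauSteps_next h).trans hτ⟩

/-- The configuration `c` of the realisation is on its way to representing the configuration `y` of
the machine on data. -/
def Represents (N : DataMachine A C D α) (s₀ : N.State) (P : Option N.Index → Routine Γ Bool)
    (sym : PointedMap Γ (Option D)) (rep : Bool × α → Tape Γ) (y : N.State × α)
    (c : RealState N P × Tape (Option D)) : Prop :=
  N.stateAfter s₀ c.1.1 = y.1 ∧ ∃ T : Tape Γ,
    c.2 = cond c.1.2.2 ((T.map sym).move .right) (T.map sym) ∧
    (P c.1.1).HaltsWith c.1.2.1 T (rep (N.flagged y)) (N.flagged y).1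

variable {rep : Bool × α → Tape Γ} {y y' : N.State × α} {c c' : RealState N P × Tape (Option D)}
  {a : CommActionTau A C D}

theorem Represents.exists_ready (h : Represents N s₀ P sym rep y c) :
    ∃ q, (N.realize s₀ P sym).lts.TauSteps c (⟨c.1.1, q, false⟩, (rep (N.flagged y)).map sym) ∧
      Represents N s₀ P sym rep y (⟨c.1.1, q, false⟩, (rep (N.flagged y)).map sym) ∧
      (P c.1.1).next q (rep (N.flagged y)).head = none ∧ (P c.1.1).out q = N.test y.1 y.2 := by
  obtain ⟨⟨r, q, displaced⟩, U⟩ := c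
  obtain ⟨hy, T, hU, hhalts⟩ := h
  obtain ⟨q', hhalts', hnext, hout, hτ⟩ := realize_tauSteps (sym := sym) (s₀ := s₀) hhalts
  refine ⟨q', ?_, ⟨hy, _, rfl, hhalts'⟩, hnext, hout⟩
  cases displaced with
  | false =>
    obtain rfl : U = T.map sym := hU
    exact hτ
  | true =>
    obtain rfl : U = (T.map sym).move .right := hU
    exact .head (realize_step_back r q _) hτ

theorem Represents.step_left
    (hP : ∀ i y, (P (some i)).Runs (rep y)
      (rep (N.flagged ((N.rule i).target, (N.rule i).update y.2)))
      (N.flagged ((N.rule i).target, (N.rule i).update y.2)).1)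
    (h : Represents N s₀ P sym rep y c) {y₀ : N.State × α} (hs : (N.lts y₀).step y a y') :
    ∃ c'' c', (N.realize s₀ P sym).lts.TauSteps c c'' ∧ (N.realize s₀ P sym).lts.OptStep c'' a c' ∧
      Represents N s₀ P sym rep y c'' ∧ Represents N s₀ P sym rep y' c' := by
  obtain ⟨i, hsource, hguard, rfl, rfl⟩ := hs
  obtain ⟨q, hτ, hready, hnext, hout⟩ := h.exists_ready
  have hfire := realize_step_map (sym := sym)
    (.fire hnext (hsource.trans h.1.symm) (Set.mem_of_eq_of_mem hout hguard))
  rw [Tape.write_self, Tape.map_move] at hfire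
  exact ⟨_, _, hτ, .inl hfire, hready, rfl, _, rfl, hP i (N.flagged y)⟩

theorem Represents.step_right (hsym : Function.Injective sym)
    (hP : ∀ i y, (P (some i)).Runs (rep y)
      (rep (N.flagged ((N.rule i).target, (N.rule i).update y.2)))
      (N.flagged ((N.rule i).target, (N.rule i).update y.2)).1)
    (h : Represents N s₀ P sym rep y c) (y₀ : N.State × α)
    (hs : (N.realize s₀ P sym).lts.step c a c') :
    ∃ y', (N.lts y₀).OptStep y a y' ∧ Represents N s₀ P sym rep y' c' := by
  obtain ⟨s, U⟩ := c
  obtain ⟨s', U'⟩ := c'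
  obtain ⟨e, m, hrel, rfl : U' = _⟩ := realize_step_iff.1 hs
  obtain ⟨hy, T, hU : U = _, hhalts⟩ := h
  generalize hd : U.head = d at hrel
  cases hrel with
  | back =>
    obtain rfl : U = (T.map sym).move .right := hU
    refine ⟨y, .inr ⟨rfl, rfl⟩, hy, T, ?_, hhalts⟩
    rw [← hd, Tape.write_self, Tape.move_right_left]
    rfl
  | move hnext =>
    obtain rfl : U = T.map sym := hU
    rw [Tape.map_fst] at hd
    obtain rfl := hsym hd
    refine ⟨y, .inr ⟨rfl, rfl⟩, hy, _, ?_, hhalts.of_next_eq_some hnext⟩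
    rw [← Tape.map_fst, Tape.write_self, ← Tape.map_move]
    rfl
  | write hnext =>
    obtain rfl : U = T.map sym := hU
    rw [Tape.map_fst] at hd
    obtain rfl := hsym hd
    refine ⟨y, .inr ⟨rfl, rfl⟩, hy, _, ?_, hhalts.of_next_eq_some hnext⟩
    rw [← Tape.map_write]
    rfl
  | @fire r q b hnext i hsource hguard =>
    obtain rfl : U = T.map sym := hU
    rw [Tape.map_fst] at hd
    obtain rfl := hsym hd
    obtain ⟨rfl, hout⟩ := hhalts.of_next_eq_none hnext
    refine ⟨_, .inl ⟨i, hsource.trans hy, Set.mem_of_eq_of_mem hout.symm hguard, rfl, rfl⟩,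
      rfl, _, ?_, hP i (N.flagged y)⟩
    rw [← Tape.map_fst, Tape.write_self]
    rfl

theorem branchingBisimilar_realize (hsym : Function.Injective sym) {y₀ : N.State × α}
    (hP₀ : (P none).Runs (Tape.mk₁ []) (rep (N.flagged y₀)) (N.flagged y₀).1)
    (hP : ∀ i y, (P (some i)).Runs (rep y)
      (rep (N.flagged ((N.rule i).target, (N.rule i).update y.2)))
      (N.flagged ((N.rule i).target, (N.rule i).update y.2)).1) :
    BranchingBisimilar (N.lts y₀) (N.realize y₀.1 P sym).lts := by
  refine branchingBisimilar_iff.2 ⟨Represents N y₀.1 P sym rep,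
    ⟨fun h _ _ hs => h.step_left hP hs,
      fun {_ c} h hy => ⟨c, .refl, h, Set.mem_of_eq_of_mem (s := N.final) h.1 hy⟩⟩,
    .of_optStep (fun h _ _ hs => h.step_right hsym hP y₀ hs)
      (fun h hc => Set.mem_of_eq_of_mem (s := N.final) h.1.symm hc),
    rfl, Tape.mk₁ [], (Tape.map_mk₁ sym []).symm, hP₀⟩

end Realisation

/-- Bits as tape symbols. -/
def bitSymbol (one : D) : PointedMap Bool (Option D) :=
  ⟨fun b => cond b (some one) none, rfl⟩

theorem bitSymbol_injective (one : D) : Function.Injective (bitSymbol one) := by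
  rintro (_ | _) (_ | _) h <;> first | rfl | cases h

theorem exists_branchingBisimilar_rtm (N : DataMachine A C D α) (y₀ : N.State × α) (one : D) :
    ∃ U : RTM.{uA, uC, uD, 0} A C D, BranchingBisimilar (N.lts y₀) U.lts := by
  obtain ⟨rep, hinit, hrep⟩ := Routine.exists_encoding α
  obtain ⟨P₀, hP₀⟩ := hinit (N.flagged y₀)
  have computable_flagged (i : N.Index) :
      Computable fun x => N.flagged ((N.rule i).target, (N.rule i).update x) :=
    ((N.computable_test _).comp (N.computable_update i)).pair (N.computable_update i)
  choose P hP using fun i => hrep _ (computable_flagged i)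
  exact ⟨_, branchingBisimilar_realize (P := fun r => r.elim P₀ P) (bitSymbol_injective one) hP₀ hP⟩

end DataMachine

/-! ### Receiving a number -/

namespace DataMachine

open TransitionSystem

variable {A : Type uA} {C : Type uC} {D : Type uD} {α : Type*} [Primcodable α]

/-- The control states of a receiver: waiting for a number, counting its digits, and running the
machine that works on the number. -/
inductive ReceiverState (σ : Type) : Type
  | wait
  | count
  | run (s : σ)

/-- The indices of the rules of a receiver: those for the symbols of a number, and those of the
machine that works on the number. -/
inductive ReceiverIndex (ι : Type) : Type
  | opening
  | digit
  | closing
  | run (i : ι)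

instance ReceiverIndex.instFinite (ι : Type) [Finite ι] : Finite (ReceiverIndex ι) :=
  Finite.of_surjective (Sum.elim ![opening, digit, closing] run) <| by
    rintro (_ | _ | _ | i)
    exacts [⟨.inl 0, rfl⟩, ⟨.inl 1, rfl⟩, ⟨.inl 2, rfl⟩, ⟨.inr i, rfl⟩]

variable (N : DataMachine A C D α) (u : C) (one lb rb : D) (s₀ : N.State) {f : ℕ → α}
  (hf : Computable f)

/-- The machine that receives a number `k` along channel `u`, represented by `k + 1` symbols `one`
between `lb` and `rb`, and then behaves like `N` started in `(s₀, f k)`. It counts the symbols `one`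
in the first component of its datum. -/
def receiver : DataMachine A C D (ℕ × α) where
  State := ReceiverState N.State
  Index := ReceiverIndex N.Index
  finite_index :=
    haveI := N.finite_index
    inferInstance
  rule
    | .opening => ⟨.wait, Set.univ, some (.recv u (some lb)), id, .count⟩
    | .digit => ⟨.count, Set.univ, some (.recv u (some one)), fun x => (x.1 + 1, x.2), .count⟩
    | .closing => ⟨.count, Set.univ, some (.recv u (some rb)), fun x => (x.1, f x.1.pred), .run s₀⟩
    | .run i => ⟨.run (N.rule i).source, (N.rule i).guard, (N.rule i).action,
        fun x => (x.1, (N.rule i).update x.2), .run (N.rule i).target⟩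
  computable_update
    | .opening => .id
    | .digit => (Computable.succ.comp .fst).pair .snd
    | .closing => .pair .fst (hf.comp (Computable.pred.comp .fst))
    | .run i => .pair .fst ((N.computable_update i).comp .snd)
  test
    | .wait, _ => false
    | .count, _ => false
    | .run s, x => N.test s x.2
  computable_test
    | .wait => .const false
    | .count => .const false
    | .run s => (N.computable_test s).comp .snd
  final := ReceiverState.run '' N.final

variable {N u one lb rb s₀ hf}

theorem receiver_step_wait_iff {x : ℕ × α} {a : CommActionTau A C D}
    {c₀ c : ReceiverState N.State × ℕ × α} :
    ((receiver N u one lb rb s₀ hf).lts c₀).step (.wait, x) a c ↔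
      a = some (.recv u (some lb)) ∧ c = (.count, x) := by
  constructor
  · rintro ⟨_ | _ | _ | i, ⟨⟩, -, rfl, rfl⟩
    exact ⟨rfl, rfl⟩
  · rintro ⟨rfl, rfl⟩
    exact ⟨.opening, rfl, trivial, rfl, rfl⟩

theorem receiver_step_count_iff {m : ℕ} {x : α} {a : CommActionTau A C D}
    {c₀ c : ReceiverState N.State × ℕ × α} :
    ((receiver N u one lb rb s₀ hf).lts c₀).step (.count, m, x) a c ↔
      (a = some (.recv u (some one)) ∧ c = (.count, m + 1, x)) ∨
      (a = some (.recv u (some rb)) ∧ c = (.run s₀, m, f m.pred)) := by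
  constructor
  · rintro ⟨_ | _ | _ | i, ⟨⟩, -, rfl, rfl⟩
    exacts [.inl ⟨rfl, rfl⟩, .inr ⟨rfl, rfl⟩]
  · rintro (⟨rfl, rfl⟩ | ⟨rfl, rfl⟩)
    exacts [⟨.digit, rfl, trivial, rfl, rfl⟩, ⟨.closing, rfl, trivial, rfl, rfl⟩]

theorem receiver_step_run_iff {s : N.State} {m : ℕ} {x : α} {a : CommActionTau A C D}
    {c₀ c : ReceiverState N.State × ℕ × α} {y₀ : N.State × α} :
    ((receiver N u one lb rb s₀ hf).lts c₀).step (.run s, m, x) a c ↔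
      ∃ y, (N.lts y₀).step (s, x) a y ∧ c = (.run y.1, m, y.2) := by
  constructor
  · rintro ⟨_ | _ | _ | i, hi, hguard, rfl, rfl⟩ <;> cases hi
    exact ⟨_, ⟨i, rfl, hguard, rfl, rfl⟩, rfl⟩
  · rintro ⟨_, ⟨i, rfl, hguard, rfl, rfl⟩, rfl⟩
    exact ⟨.run i, rfl, hguard, rfl, rfl⟩

theorem receiver_receives_digits (h : one ≠ rb) (c₀ : ReceiverState N.State × ℕ × α) (n m : ℕ)
    (x : α) : ((receiver N u one lb rb s₀ hf).lts c₀).Receives u (.count, m, x)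
      (List.replicate n one ++ [rb]) (.run s₀, m + n, f (m + n).pred) := by
  induction n generalizing m with
  | zero =>
    refine .cons (receiver_step_count_iff.2 (.inr ⟨rfl, rfl⟩)) (fun a c hc => ?_) (.nil _)
    obtain ⟨rfl, rfl⟩ | ⟨rfl, rfl⟩ := receiver_step_count_iff.1 hc
    · exact ⟨_, rfl, fun h' => absurd (Option.some.inj h') h⟩
    · exact ⟨_, rfl, fun _ => rfl⟩
  | succ n ih =>
    refine .cons (receiver_step_count_iff.2 (.inl ⟨rfl, rfl⟩)) (fun a c hc => ?_) ?_
    · obtain ⟨rfl, rfl⟩ | ⟨rfl, rfl⟩ := receiver_step_count_iff.1 hc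
      · exact ⟨_, rfl, fun _ => rfl⟩
      · exact ⟨_, rfl, fun h' => absurd (Option.some.inj h').symm h⟩
    · rw [← Nat.succ_add_eq_add_succ m n]
      exact ih (m + 1)

theorem receiver_receives_number (h : one ≠ rb) (c₀ : ReceiverState N.State × ℕ × α) (k : ℕ)
    (x : α) : ((receiver N u one lb rb s₀ hf).lts c₀).Receives u (.wait, 0, x)
      ([lb] ++ List.replicate (k + 1) one ++ [rb]) (.run s₀, k + 1, f k) := by
  have hdigits := receiver_receives_digits (u := u) (lb := lb) (s₀ := s₀) (hf := hf)
    h c₀ (k + 1) 0 x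
  rw [Nat.zero_add] at hdigits
  refine .cons (receiver_step_wait_iff.2 ⟨rfl, rfl⟩) (fun a c hc => ?_) hdigits
  obtain ⟨rfl, rfl⟩ := receiver_step_wait_iff.1 hc
  exact ⟨_, rfl, fun _ => rfl⟩

theorem branchingBisimilar_receiver_run (m : ℕ) (c₀ : N.State × α) :
    BranchingBisimilar (N.lts c₀)
      ((receiver N u one lb rb s₀ hf).lts (.run c₀.1, m, c₀.2)) := by
  refine branchingBisimilar_iff.2 ⟨fun y c => ∃ m, c = (.run y.1, m, y.2),
    .of_optStep ?_ ?_, .of_optStep ?_ ?_, m, rfl⟩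
  · rintro y _ ⟨m, rfl⟩ a y' hs
    exact ⟨_, .inl (receiver_step_run_iff.2 ⟨y', hs, rfl⟩), m, rfl⟩
  · rintro y _ ⟨m, rfl⟩ hy
    exact ⟨y.1, hy, rfl⟩
  · rintro _ y ⟨m, rfl⟩ a c hs
    obtain ⟨y', hs', rfl⟩ := (receiver_step_run_iff (y₀ := c₀)).1 hs
    exact ⟨y', .inl hs', m, rfl⟩
  · rintro _ y ⟨m, rfl⟩ ⟨s, hs, ⟨⟩⟩
    exact hs

theorem branchingBisimilar_parallel_receiver (h : one ≠ rb)
    (hN : ∀ i, ¬ CommunicatesOn {u} (N.rule i).action) (k : ℕ) (x : α) :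
    BranchingBisimilar (N.lts (s₀, f k)) (parallel {u} (RTM.sendNumber A u one lb rb k).lts
      ((receiver N u one lb rb s₀ hf).lts (.wait, 0, x))) := by
  refine (branchingBisimilar_receiver_run (k + 1) (s₀, f k)).trans
    ((receiver_receives_number h _ k x).branchingBisimilar
      (S := Prod.fst ⁻¹' Set.range ReceiverState.run) (Set.mem_range_self s₀) ?_)
  rintro ⟨_, m, x⟩ ⟨s, rfl⟩ a _ hs
  obtain ⟨y, ⟨i, -, -, rfl, -⟩, rfl⟩ := (receiver_step_run_iff (y₀ := (s₀, x))).1 hs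
  exact ⟨hN i, y.1, rfl⟩

end DataMachine

/-! ### Interpreting Gödel numbers -/

namespace RTM

open Turing

/-- The state, the scanned symbol, and the parts of the tape to the left and to the right of the
head, all of them coded. Both parts are listed from the head outwards, and the cells beyond the end
of a list are blank. -/
abbrev CodedConfig := ℕ × ℕ × List ℕ × List ℕ

/-- The components of a transition, in the order of `RTM.rel`, all but the direction coded by
numbers. -/
abbrev CodedTransition := ℕ × ℕ × ℕ × ℕ × Bool × ℕ

/-- The data of the interpreter: the numbers of the final states and of the transitions of the
interpreted machine, its configuration, and a candidate for the number of its next transition. -/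
abbrev InterpreterData := List ℕ × List ℕ × CodedConfig × ℕ

/-- The coded transition with a given number. -/
def decodeTransition (i : ℕ) : CodedTransition := (Encodable.decode i).getD default

theorem primrec_decodeTransition : Primrec decodeTransition :=
  Primrec.option_getD.comp .decode (.const _)

theorem primrec_decide_mem {β : Type*} [Primcodable β] {f : β → ℕ} {g : β → List ℕ}
    (hf : Primrec f) (hg : Primrec g) : Primrec fun b => decide (f b ∈ g b) :=
  ((Primrec.nat_lt.comp (Primrec.list_idxOf.comp hf hg) (Primrec.list_length.comp hg)).of_eq
    fun _ => List.idxOf_lt_length_iff).decide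

/-- The coded configuration that results from executing a transition. -/
def CodedTransition.apply : CodedTransition → CodedConfig → CodedConfig
  | (_, _, _, e, m, q), (_, _, L, R) =>
    bif m then (q, R.headI, e :: L, R.tail) else (q, L.headI, L.tail, e :: R)

open Primrec in
theorem CodedTransition.primrec_apply : Primrec₂ CodedTransition.apply := by
  have ht : Primrec fun p : CodedTransition × CodedConfig => p.1.2.2.2 :=
    snd.comp (snd.comp (snd.comp fst))
  have he := fst.comp ht
  have hq := snd.comp (snd.comp ht)
  have hL : Primrec fun p : CodedTransition × CodedConfig => p.2.2.2.1 :=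
    fst.comp (snd.comp (snd.comp snd))
  have hR : Primrec fun p : CodedTransition × CodedConfig => p.2.2.2.2 :=
    snd.comp (snd.comp (snd.comp snd))
  exact .cond (fst.comp (snd.comp ht))
    (hq.pair ((list_headI.comp hR).pair ((list_cons.comp he hL).pair (list_tail.comp hR))))
    (hq.pair ((list_headI.comp hL).pair ((list_tail.comp hL).pair (list_cons.comp he hR))))

namespace InterpreterData

/-- Whether the interpreted machine is in a final state. -/
def atFinal : InterpreterData → Bool
  | (F, _, (q, _), _) => decide (q ∈ F)

/-- Whether the candidate is the number of a transition that can be taken in the current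
configuration and whose action has the number `a`. -/
def applicable (a : ℕ) : InterpreterData → Bool
  | (_, Δ, (q, d, _), i) => decide (i ∈ Δ) && ((decodeTransition i).1 == q &&
    ((decodeTransition i).2.1 == d && (decodeTransition i).2.2.1 == a))

/-- Execute the candidate transition. -/
def execute : InterpreterData → InterpreterData
  | (F, Δ, c, i) => (F, Δ, (decodeTransition i).apply c, i)

/-- Replace the candidate. -/
def withCandidate : InterpreterData → ℕ → InterpreterData
  | (F, Δ, c, _), i => (F, Δ, c, i)

/-- The data for interpreting the machine with Gödel number `k` from its initial configuration. -/
def init (k : ℕ) : InterpreterData :=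
  let p : ℕ × ℕ × List ℕ × List ℕ := (Encodable.decode k).getD default
  (p.2.2.1, p.2.2.2, (p.2.1, 0, [], []), 0)

theorem primrec_config : Primrec fun y : InterpreterData => y.2.2.1 :=
  Primrec.fst.comp (Primrec.snd.comp Primrec.snd)

theorem primrec_candidate : Primrec fun y : InterpreterData => y.2.2.2 :=
  Primrec.snd.comp (Primrec.snd.comp Primrec.snd)

section Primrec

open Primrec

theorem primrec_atFinal : Primrec atFinal :=
  primrec_decide_mem (fst.comp primrec_config) fst

attribute [local irreducible] decodeTransition in
theorem primrec_applicable (a : ℕ) : Primrec (applicable a) := by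
  have ht := primrec_decodeTransition.comp primrec_candidate
  have hmem := primrec_decide_mem primrec_candidate (fst.comp snd)
  have hq := Primrec.beq.comp (fst.comp ht) (fst.comp primrec_config)
  have hd := Primrec.beq.comp (fst.comp (snd.comp ht)) (fst.comp (snd.comp primrec_config))
  have ha := Primrec.beq.comp (fst.comp (snd.comp (snd.comp ht))) (.const a)
  exact Primrec.and.comp hmem (Primrec.and.comp hq (Primrec.and.comp hd ha))

theorem primrec_execute : Primrec execute :=
  fst.pair ((fst.comp snd).pair (.pair (CodedTransition.primrec_apply.comp
    (primrec_decodeTransition.comp primrec_candidate) primrec_config) primrec_candidate))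

theorem primrec_withCandidate : Primrec₂ withCandidate :=
  (fst.comp fst).pair ((fst.comp (snd.comp fst)).pair ((primrec_config.comp fst).pair snd))

theorem primrec_init : Primrec init := by
  have hp : Primrec fun k : ℕ =>
      ((Encodable.decode k).getD default : ℕ × ℕ × List ℕ × List ℕ) :=
    option_getD.comp .decode (.const _)
  have hq := snd.comp (snd.comp hp)
  exact (fst.comp hq).pair ((snd.comp hq).pair
    (.pair ((fst.comp (snd.comp hp)).pair (.const _)) (.const 0)))

end Primrec

end InterpreterData

/-- The control states of an interpreter: looking for a candidate, attempting to execute the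
candidate with the action labelled `l`, and having reported termination. -/
inductive InterpreterState (L : Type) : Type
  | search
  | attempt (l : L)
  | halted

/-- The indices of the rules of an interpreter. -/
inductive InterpreterIndex (L : Type) : Type
  | reset
  | advance
  | attempt (l : L)
  | abandon (l : L)
  | execute (l : L)
  | halt
  | resume

instance InterpreterIndex.instFinite (L : Type) [Finite L] : Finite (InterpreterIndex L) :=
  Finite.of_surjective
    (Sum.elim ![reset, advance, halt, resume] (Sum.elim attempt (Sum.elim abandon execute))) <| by
    rintro (_ | _ | l | l | l | _ | _)
    exacts [⟨.inl 0, rfl⟩, ⟨.inl 1, rfl⟩, ⟨.inr (.inl l), rfl⟩, ⟨.inr (.inr (.inl l)), rfl⟩,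
      ⟨.inr (.inr (.inr l)), rfl⟩, ⟨.inl 2, rfl⟩, ⟨.inl 3, rfl⟩]

section Interpreter

variable {A : Type uA} {C : Type uC} {D : Type uD} [Encodable A] [Encodable C] [Encodable D]
  {L : Type} [Finite L] (act : L → CommActionTau A C D)

/-- The interpreter of reactive Turing machines whose actions are among the values of `act`. It can
change its candidate and give up an attempt at any time, and it resumes after reporting termination,
so that none of its silent steps discards a possible behaviour. -/
def interpreter : DataMachine A C D InterpreterData where
  State := InterpreterState L
  Index := InterpreterIndex L
  finite_index := inferInstance
  rule
    | .reset => ⟨.search, Set.univ, none, fun y => y.withCandidate 0, .search⟩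
    | .advance => ⟨.search, Set.univ, none, fun y => y.withCandidate (y.2.2.2 + 1), .search⟩
    | .attempt l => ⟨.search, Set.univ, none, id, .attempt l⟩
    | .abandon l => ⟨.attempt l, Set.univ, none, id, .search⟩
    | .execute l => ⟨.attempt l, {true}, act l, InterpreterData.execute, .search⟩
    | .halt => ⟨.search, {true}, none, id, .halted⟩
    | .resume => ⟨.halted, Set.univ, none, id, .search⟩
  computable_update
    | .reset => (InterpreterData.primrec_withCandidate.comp .id (.const 0)).to_comp
    | .advance =>
      (InterpreterData.primrec_withCandidate.comp .id
        (Primrec.succ.comp InterpreterData.primrec_candidate)).to_comp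
    | .attempt _ => .id
    | .abandon _ => .id
    | .execute _ => InterpreterData.primrec_execute.to_comp
    | .halt => .id
    | .resume => .id
  test
    | .search => InterpreterData.atFinal
    | .attempt l => InterpreterData.applicable (Encodable.encode (act l))
    | .halted => fun _ => false
  computable_test
    | .search => InterpreterData.primrec_atFinal.to_comp
    | .attempt _ => (InterpreterData.primrec_applicable _).to_comp
    | .halted => .const false
  final := {.halted}

variable {act} {x₀ : (interpreter act).State × InterpreterData}

theorem interpreter_tauSteps_search (s : InterpreterState L) (y : InterpreterData) :
    ((interpreter act).lts x₀).TauSteps (s, y) (.search, y) :=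
  match s with
  | .search => .refl
  | .attempt l => .single ⟨.abandon l, rfl, trivial, rfl, rfl⟩
  | .halted => .single ⟨.resume, rfl, trivial, rfl, rfl⟩

theorem interpreter_tauSteps_withCandidate (y : InterpreterData) (i : ℕ) :
    ((interpreter act).lts x₀).TauSteps (.search, y) (.search, y.withCandidate i) := by
  induction i with
  | zero => exact .single ⟨.reset, rfl, trivial, rfl, rfl⟩
  | succ i ih => exact ih.tail ⟨.advance, rfl, trivial, rfl, rfl⟩

end Interpreter

variable {A : Type uA} {C : Type uC} {D : Type uD} {M : RTM.{uA, uC, uD, v} A C D} {n : ℕ}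
  {ν : M.State ≃ Fin n}

theorem mem_finalCodes_iff {s : M.State} : (ν s : ℕ) ∈ M.finalCodes ν ↔ s ∈ M.final := by
  rw [finalCodes, Set.Finite.mem_toFinset]
  exact (Fin.val_injective.comp ν.injective).mem_set_image

variable [Encodable A] [Encodable C] [Encodable D]

theorem decodeTransition_transCode (s : M.State) (d : Option D) (a : CommActionTau A C D)
    (e : Option D) (m : Dir) (t : M.State) :
    decodeTransition (transCode ν (s, d, a, e, m, t)) = ((ν s : ℕ), Encodable.encode d,
      Encodable.encode a, Encodable.encode e, dirEquivBool m, (ν t : ℕ)) := by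
  have : transCode ν (s, d, a, e, m, t) = Encodable.encode (((ν s : ℕ), Encodable.encode d,
      Encodable.encode a, Encodable.encode e, dirEquivBool m, (ν t : ℕ)) : CodedTransition) := rfl
  rw [this, decodeTransition, Encodable.encodek, Option.getD_some]

theorem headI_map_encode (L : List (Option D)) :
    (L.map Encodable.encode).headI = Encodable.encode L.headI := by
  cases L <;> rfl

variable [Finite A] [Finite C] [Finite D]

attribute [local irreducible] transCode decodeTransition

theorem mem_transCodes_iff {i : ℕ} : i ∈ M.transCodes ν ↔ ∃ p ∈ M.rel, transCode ν p = i := by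
  rw [transCodes, Set.Finite.mem_toFinset]
  rfl

/-- The data of the interpreter represent the machine `M` in a given configuration. -/
inductive Represents (ν : M.State ≃ Fin n) : M.lts.State → InterpreterData → Prop
  | mk (q : M.State) (d : Option D) (L R : List (Option D)) (i : ℕ) :
    Represents ν (q, ⟨d, .mk L, .mk R⟩) ((M.finalCodes ν).sort (· ≤ ·),
      (M.transCodes ν).sort (· ≤ ·),
      ((ν q : ℕ), Encodable.encode d, L.map Encodable.encode, R.map Encodable.encode), i)

namespace Represents

variable {c c' : M.lts.State} {y : InterpreterData} {a : CommActionTau A C D}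

theorem init : Represents ν M.lts.init (.init (M.godelNumber ν)) := by
  have hinit : InterpreterData.init (M.godelNumber ν) = ((M.finalCodes ν).sort (· ≤ ·),
      (M.transCodes ν).sort (· ≤ ·), ((ν M.init : ℕ), 0, [], []), 0) := by
    rw [InterpreterData.init, godelNumber, Encodable.encodek]
    rfl
  rw [hinit]
  exact .mk M.init none [] [] 0

theorem withCandidate (h : Represents ν c y) (i : ℕ) : Represents ν c (y.withCandidate i) := by
  obtain ⟨q, d, L, R, -⟩ := h
  exact .mk q d L R i

theorem atFinal_iff (h : Represents ν c y) : y.atFinal = true ↔ c ∈ M.lts.final := by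
  obtain ⟨q, d, L, R, i⟩ := h
  exact decide_eq_true_iff.trans ((Finset.mem_sort _).trans mem_finalCodes_iff)

theorem execute (h : Represents ν c y) {s d a : ℕ} {e : Option D} {m : Dir} {t : M.State}
    (hy : decodeTransition y.2.2.2 = (s, d, a, Encodable.encode e, dirEquivBool m, (ν t : ℕ))) :
    Represents ν (t, (c.2.write e).move m) y.execute := by
  obtain ⟨q, d, L, R, i⟩ := h
  replace hy : decodeTransition i = _ := hy
  cases m <;> simp only [InterpreterData.execute, hy, CodedTransition.apply, dirEquivBool,
    headI_map_encode, cond_true, cond_false, Equiv.coe_fn_mk, ← List.map_cons, ← List.map_tail]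
  · exact .mk t L.headI L.tail (e :: R) i
  · exact .mk t R.headI (e :: L) R.tail i

theorem exists_step (h : Represents ν c y) (hy : y.applicable (Encodable.encode a) = true) :
    ∃ c', M.lts.step c a c' ∧ Represents ν c' y.execute := by
  have hexecute := @h.execute
  obtain ⟨q, d, L, R, i⟩ := h
  simp only [InterpreterData.applicable, Bool.and_eq_true, decide_eq_true_iff, beq_iff_eq,
    Finset.mem_sort] at hy
  obtain ⟨hi, hq, hd, ha⟩ := hy
  obtain ⟨⟨q', d', a', e, m, t⟩, hrel, rfl⟩ := mem_transCodes_iff.1 hi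
  have hdecode := decodeTransition_transCode (ν := ν) q' d' a' e m t
  rw [hdecode] at hq hd ha
  obtain rfl := ν.injective (Fin.ext hq)
  obtain rfl := Encodable.encode_injective hd
  obtain rfl := Encodable.encode_injective ha
  exact ⟨_, ⟨e, m, hrel, rfl⟩, hexecute hdecode⟩

theorem exists_candidate (h : Represents ν c y) (hs : M.lts.step c a c') :
    ∃ i, (y.withCandidate i).applicable (Encodable.encode a) = true ∧
      Represents ν c' (y.withCandidate i).execute := by
  obtain ⟨t, T⟩ := c'
  obtain ⟨e, m, hrel, rfl : T = _⟩ := hs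
  have hdecode := decodeTransition_transCode (ν := ν) c.1 c.2.head a e m t
  refine ⟨_, ?_, (h.withCandidate _).execute hdecode⟩
  obtain ⟨q, d, L, R, i⟩ := h
  simp only [InterpreterData.applicable, InterpreterData.withCandidate, hdecode, Bool.and_eq_true,
    decide_eq_true_iff, beq_iff_eq, Finset.mem_sort, and_true]
  exact mem_transCodes_iff.2 ⟨_, hrel, rfl⟩

end Represents

section Simulation

open TransitionSystem

variable {L : Type} [Finite L] {act : L → CommActionTau A C D}
  {x₀ : (interpreter act).State × InterpreterData}

/-- The relation between the configurations of `M` and those of its interpreter. -/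
def InterpreterRel (act : L → CommActionTau A C D) (ν : M.State ≃ Fin n) (c : M.lts.State)
    (x : (interpreter act).State × InterpreterData) : Prop :=
  Represents ν c x.2 ∧ (x.1 = InterpreterState.halted → c ∈ M.lts.final)

theorem isBranchingSimulation_interpreterRel (hact : ∀ p ∈ M.rel, p.2.2.1 ∈ Set.range act) :
    IsBranchingSimulation M.lts ((interpreter act).lts x₀) (InterpreterRel act ν) where
  step := by
    rintro c ⟨s, y⟩ ⟨hc, -⟩ a c' hstep
    obtain ⟨e, m, hrel, -⟩ := id hstep
    obtain ⟨l, rfl⟩ := hact _ hrel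
    obtain ⟨i, hi, hc'⟩ := hc.exists_candidate hstep
    exact ⟨(.attempt l, y.withCandidate i), (.search, (y.withCandidate i).execute),
      ((interpreter_tauSteps_search s y).trans (interpreter_tauSteps_withCandidate y i)).tail
        ⟨.attempt l, rfl, trivial, rfl, rfl⟩,
      .inl ⟨.execute l, rfl, hi, rfl, rfl⟩, ⟨hc.withCandidate i, nofun⟩, hc', nofun⟩
  final := by
    rintro c ⟨s, y⟩ ⟨hc, -⟩ hfinal
    exact ⟨(.halted, y), (interpreter_tauSteps_search s y).tail
      ⟨.halt, rfl, hc.atFinal_iff.2 hfinal, rfl, rfl⟩, ⟨hc, fun _ => hfinal⟩, rfl⟩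

theorem isBranchingSimulation_flip_interpreterRel :
    IsBranchingSimulation ((interpreter act).lts x₀) M.lts (flip (InterpreterRel act ν)) :=
  .of_optStep
    (by
      rintro ⟨_, y⟩ c ⟨hc, -⟩ _ _ ⟨_ | _ | l | l | l | _ | _, ⟨⟩, htest, rfl, rfl⟩
      · exact ⟨c, .inr ⟨rfl, rfl⟩, hc.withCandidate _, nofun⟩
      · exact ⟨c, .inr ⟨rfl, rfl⟩, hc.withCandidate _, nofun⟩
      · exact ⟨c, .inr ⟨rfl, rfl⟩, hc, nofun⟩
      · exact ⟨c, .inr ⟨rfl, rfl⟩, hc, nofun⟩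
      · obtain ⟨c', hstep, hc'⟩ := hc.exists_step htest
        exact ⟨c', .inl hstep, hc', nofun⟩
      · exact ⟨c, .inr ⟨rfl, rfl⟩, hc, fun _ => hc.atFinal_iff.1 htest⟩
      · exact ⟨c, .inr ⟨rfl, rfl⟩, hc, nofun⟩)
    fun hc hfinal => hc.2 hfinal

theorem branchingBisimilar_interpreter (hact : ∀ p ∈ M.rel, p.2.2.1 ∈ Set.range act) :
    BranchingBisimilar M.lts ((interpreter act).lts (.search, .init (M.godelNumber ν))) :=
  branchingBisimilar_iff.2 ⟨InterpreterRel act ν, isBranchingSimulation_interpreterRel hact,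
    isBranchingSimulation_flip_interpreterRel, .init, nofun⟩

end Simulation

end RTM

theorem mainTheorem6 {A : Type uA} {C : Type uC} {D : Type uD}
    [Finite A] [Finite C] [Finite D] [Encodable A] [Encodable C] [Encodable D]
    (u : C) (one lb rb : D) (h_one_lb : one ≠ lb) (h_one_rb : one ≠ rb) (h_lb_rb : lb ≠ rb) :
    ∃ U : RTM.{uA, uC, uD, 0} A C D,
      ∀ M : RTM.{uA, uC, uD, v} A C D, M.DoesNotUse u →
        ∀ (n : ℕ) (ν : M.State ≃ Fin n),
          TransitionSystem.BranchingBisimilar M.lts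
            (TransitionSystem.parallel {u}
              (RTM.sendNumber A u one lb rb (M.godelNumber ν)).lts U.lts) := by
  obtain ⟨m, ⟨e⟩⟩ := Finite.exists_equiv_fin
    {a : CommActionTau A C D // ¬ TransitionSystem.CommunicatesOn {u} a}
  let act (j : Fin m) : CommActionTau A C D := e.symm j
  have hact : ∀ i, ¬ TransitionSystem.CommunicatesOn {u} ((RTM.interpreter act).rule i).action
    | .execute j => (e.symm j).2
    | .reset | .advance | .attempt _ | .abandon _ | .halt | .resume =>
      TransitionSystem.not_communicatesOn_none
  obtain ⟨U, hU⟩ := DataMachine.exists_branchingBisimilar_rtm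
    ((RTM.interpreter act).receiver u one lb rb .search RTM.InterpreterData.primrec_init.to_comp)
    (.wait, 0, RTM.InterpreterData.init 0) one
  refine ⟨U, fun M hM n ν => ?_⟩
  have hrange : ∀ p ∈ M.rel, p.2.2.1 ∈ Set.range act := fun ⟨s, d, a, d', m, t⟩ hp =>
    ⟨e ⟨a, hM s d a d' m t hp⟩, congrArg Subtype.val (e.symm_apply_apply _)⟩
  exact (RTM.branchingBisimilar_interpreter hrange).trans
    ((DataMachine.branchingBisimilar_parallel_receiver h_one_rb hact _ _).trans
      (hU.parallel_right {u} _))
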